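/- Let $K$ be a field and let $A$ be a finitely generated (associative, unital) prime $K$-algebra of quadratic growth: for every finite-dimensional $K$-subspace $V\subseteq A$ that contains $1$ and generates $A$ as a $K$-algebra there are constants $C_1,C_2>0$ with $C_1n^2<\dim_K V^n<C_2n^2$ for all $n\ge 1$. Let $Z$ denote the extended centre of $A$, i.e. the centre of the Martindale ring of quotients of $A$ (the ring of right $A$-module homomorphisms $I\to A$ with $I$ a nonzero two-sided ideal of $A$, two of them being identified if they agree on a nonzero two-sided ideal contained in both domains). Then either $A$ satisfies a polynomial identity over $K$, or $Z$ is algebraic over $K$. In particular, if $K$ is algebraically closed and $A$ does not satisfy a polynomial identity, then $A$ is centrally closed, i.e. $Z=K$. -/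

import Mathlib

/-- A (not necessarily commutative) ring is prime if it is nonzero and `a A b = 0` only when
`a = 0` or `b = 0`; equivalently, the product of two nonzero two-sided ideals is nonzero. -/
class IsPrimeRing (A : Type*) [Ring A] : Prop where
  nontrivial : Nontrivial A
  eq_zero_or_eq_zero : ∀ a b : A, (∀ r : A, a * r * b = 0) → a = 0 ∨ b = 0

/-- `A` satisfies a polynomial identity over `K`: some nonzero polynomial over `K` in
noncommuting variables vanishes under every substitution of elements of `A`. -/
def IsPIAlgebra (K A : Type*) [Field K] [Ring A] [Algebra K A] : Prop :=
  ∃ p : FreeAlgebra K ℕ, p ≠ 0 ∧ ∀ v : ℕ → A, FreeAlgebra.lift K v p = 0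

/-- A frame of a `K`-algebra: a finite dimensional subspace that contains `1` and generates the
algebra. -/
structure IsFrame {K A : Type*} [Field K] [Ring A] [Algebra K A] (V : Submodule K A) : Prop where
  one_mem : (1 : A) ∈ V
  finite : FiniteDimensional K V
  adjoin_eq_top : Algebra.adjoin K (V : Set A) = ⊤

/-- Quadratic growth: for every frame `V` there are positive constants `C₁`, `C₂` with
`C₁ n² < dim Vⁿ < C₂ n²` for all `n ≥ 1`. Here `Vⁿ` is the span of all products of `n` elements
of `V`. (The notion is meant for finitely generated algebras, which have frames.) -/
def HasQuadraticGrowth (K A : Type*) [Field K] [Ring A] [Algebra K A] : Prop :=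
  ∀ V : Submodule K A, IsFrame V →
    ∃ C₁ C₂ : ℝ, 0 < C₁ ∧ 0 < C₂ ∧ ∀ n : ℕ, 1 ≤ n →
      C₁ * (n : ℝ) ^ 2 < (Module.finrank K ↥(V ^ n) : ℝ) ∧
      (Module.finrank K ↥(V ^ n) : ℝ) < C₂ * (n : ℝ) ^ 2

/-- A right `A`-module homomorphism `I → A` defined on a nonzero two-sided ideal `I` of `A`. -/
structure IdealHom (A : Type*) [Ring A] where
  dom : TwoSidedIdeal A
  dom_ne_bot : dom ≠ ⊥
  hom : dom →ₗ[Aᵐᵒᵖ] A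

namespace IdealHom

variable {A : Type*} [Ring A]

theorem ne_bot_iff {I : TwoSidedIdeal A} : I ≠ ⊥ ↔ ∃ x ∈ I, x ≠ 0 := by
  constructor
  · intro h
    by_contra hc
    push Not at hc
    exact h (le_bot_iff.1 fun x hx => by
      rw [TwoSidedIdeal.mem_bot]; exact hc x hx)
  · rintro ⟨x, hx, h0⟩ rfl
    exact h0 ((TwoSidedIdeal.mem_bot A).1 hx)

theorem hom_mul (f : IdealHom A) (x : A) (hx : x ∈ f.dom) (a : A) (h : x * a ∈ f.dom) :
    f.hom ⟨x * a, h⟩ = f.hom ⟨x, hx⟩ * a :=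
  f.hom.map_smul (MulOpposite.op a) ⟨x, hx⟩

theorem hom_add (f : IdealHom A) (x y : A) (hx : x ∈ f.dom) (hy : y ∈ f.dom)
    (h : x + y ∈ f.dom) : f.hom ⟨x + y, h⟩ = f.hom ⟨x, hx⟩ + f.hom ⟨y, hy⟩ :=
  f.hom.map_add ⟨x, hx⟩ ⟨y, hy⟩

/-- Build a right module homomorphism on an ideal from a map that is additive and commutes with
right multiplication. -/
def mkHom (I : TwoSidedIdeal A) (φ : I → A)
    (hadd : ∀ x y : I, φ (x + y) = φ x + φ y)
    (hmul : ∀ (x : A) (hx : x ∈ I) (a : A),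
      φ ⟨x * a, I.mul_mem_right _ _ hx⟩ = φ ⟨x, hx⟩ * a) : I →ₗ[Aᵐᵒᵖ] A where
  toFun := φ
  map_add' := hadd
  map_smul' a x := hmul x.1 x.2 a.unop

/-- The largest two-sided ideal contained in `g⁻¹(J)`. -/
def pre (g : IdealHom A) (J : TwoSidedIdeal A) : TwoSidedIdeal A :=
  TwoSidedIdeal.mk' {x | ∀ r : A, ∃ h : r * x ∈ g.dom, g.hom ⟨r * x, h⟩ ∈ J}
    (fun r => by
      refine ⟨by simp [g.dom.zero_mem], ?_⟩
      have : (⟨r * 0, by simp [g.dom.zero_mem]⟩ : g.dom) = 0 := by ext; simp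
      rw [this, map_zero]; exact J.zero_mem)
    (fun {x y} hx hy r => by
      obtain ⟨h1, h2⟩ := hx r
      obtain ⟨h3, h4⟩ := hy r
      simp only [mul_add]
      exact ⟨g.dom.add_mem h1 h3, by rw [hom_add g _ _ h1 h3]; exact J.add_mem h2 h4⟩)
    (fun {x} hx r => by
      obtain ⟨h1, h2⟩ := hx (-r)
      have e : r * -x = -r * x := by simp
      simp only [e]
      exact ⟨h1, h2⟩)
    (fun {s x} hx r => by
      obtain ⟨h1, h2⟩ := hx (r * s)
      simp only [← mul_assoc]
      exact ⟨h1, h2⟩)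
    (fun {x a} hx r => by
      obtain ⟨h1, h2⟩ := hx r
      simp only [← mul_assoc]
      exact ⟨g.dom.mul_mem_right _ _ h1, by
        rw [hom_mul g _ h1]; exact J.mul_mem_right _ _ h2⟩)

theorem mem_pre {g : IdealHom A} {J : TwoSidedIdeal A} {x : A} :
    x ∈ g.pre J ↔ ∀ r : A, ∃ h : r * x ∈ g.dom, g.hom ⟨r * x, h⟩ ∈ J := by
  unfold pre
  rw [TwoSidedIdeal.mem_mk']
  rfl

theorem exists_of_mem_pre {g : IdealHom A} {J : TwoSidedIdeal A} {x : A} (h : x ∈ g.pre J) :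
    ∃ h : x ∈ g.dom, g.hom ⟨x, h⟩ ∈ J := by
  simpa using mem_pre.1 h 1

/-- Two homomorphisms are equivalent if they agree on some nonzero ideal contained in both
domains. -/
def Rel (f g : IdealHom A) : Prop :=
  ∃ J : TwoSidedIdeal A, J ≠ ⊥ ∧
    ∀ x ∈ J, ∃ (hf : x ∈ f.dom) (hg : x ∈ g.dom), f.hom ⟨x, hf⟩ = g.hom ⟨x, hg⟩

variable [IsPrimeRing A]

theorem inf_ne_bot {I J : TwoSidedIdeal A} (hI : I ≠ ⊥) (hJ : J ≠ ⊥) : I ⊓ J ≠ ⊥ := by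
  rw [ne_bot_iff] at *
  obtain ⟨a, ha, ha0⟩ := hI
  obtain ⟨b, hb, hb0⟩ := hJ
  by_contra hc
  push Not at hc
  rcases IsPrimeRing.eq_zero_or_eq_zero a b (fun r => hc _ ((TwoSidedIdeal.mem_inf A).2
    ⟨I.mul_mem_right _ _ (I.mul_mem_right _ _ ha), J.mul_mem_left _ _ hb⟩)) with h | h
  · exact ha0 h
  · exact hb0 h

theorem pre_ne_bot (g : IdealHom A) {J : TwoSidedIdeal A} (hJ : J ≠ ⊥) : g.pre J ≠ ⊥ := by
  have hI := g.dom_ne_bot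
  rw [ne_bot_iff] at *
  obtain ⟨a, ha, ha0⟩ := hI
  obtain ⟨b, hb, hb0⟩ := hJ
  by_contra hc
  push Not at hc
  rcases IsPrimeRing.eq_zero_or_eq_zero a b (fun r => hc _ (mem_pre.2 fun s => by
    have h1 : s * a ∈ g.dom := g.dom.mul_mem_left _ _ ha
    have e : s * (a * r * b) = (s * a) * (r * b) := by simp only [mul_assoc]
    simp only [e]
    refine ⟨g.dom.mul_mem_right _ _ h1, ?_⟩
    rw [hom_mul g _ h1]
    exact J.mul_mem_left _ _ (J.mul_mem_left _ _ hb))) with h | h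
  · exact ha0 h
  · exact hb0 h

theorem top_ne_bot : (⊤ : TwoSidedIdeal A) ≠ ⊥ := by
  have := IsPrimeRing.nontrivial (A := A)
  exact ne_bot_iff.2 ⟨1, trivial, one_ne_zero⟩

theorem Rel.of_eq {f g : IdealHom A}
    (h : ∀ x hf hg, f.hom ⟨x, hf⟩ = g.hom ⟨x, hg⟩) : Rel f g :=
  ⟨f.dom ⊓ g.dom, inf_ne_bot f.dom_ne_bot g.dom_ne_bot, fun x hx =>
    ⟨((TwoSidedIdeal.mem_inf A).1 hx).1, ((TwoSidedIdeal.mem_inf A).1 hx).2, h _ _ _⟩⟩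

theorem rel_equivalence : Equivalence (Rel (A := A)) where
  refl _ := Rel.of_eq fun _ _ _ => rfl
  symm := fun ⟨J, hJ, h⟩ => ⟨J, hJ, fun x hx => by
    obtain ⟨h1, h2, h3⟩ := h x hx
    exact ⟨h2, h1, h3.symm⟩⟩
  trans := fun ⟨J, hJ, h⟩ ⟨L, hL, h'⟩ => ⟨J ⊓ L, inf_ne_bot hJ hL, fun x hx => by
    obtain ⟨h1, h2, h3⟩ := h x ((TwoSidedIdeal.mem_inf A).1 hx).1
    obtain ⟨h4, h5, h6⟩ := h' x ((TwoSidedIdeal.mem_inf A).1 hx).2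
    exact ⟨h1, h5, h3.trans h6⟩⟩

instance setoid (A : Type*) [Ring A] [IsPrimeRing A] : Setoid (IdealHom A) :=
  ⟨Rel, rel_equivalence⟩

/-- Left multiplication by `a`, defined on all of `A`. -/
def lmul (a : A) : IdealHom A where
  dom := ⊤
  dom_ne_bot := top_ne_bot
  hom := mkHom ⊤ (fun x => a * x.1) (fun x y => mul_add a x.1 y.1)
    (fun x _ b => (mul_assoc a x b).symm)

/-- The pointwise sum, on the intersection of the domains. -/
def add (f g : IdealHom A) : IdealHom A where
  dom := f.dom ⊓ g.dom
  dom_ne_bot := inf_ne_bot f.dom_ne_bot g.dom_ne_bot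
  hom := mkHom (f.dom ⊓ g.dom)
    (fun x => f.hom ⟨x.1, ((TwoSidedIdeal.mem_inf A).1 x.2).1⟩ +
      g.hom ⟨x.1, ((TwoSidedIdeal.mem_inf A).1 x.2).2⟩)
    (fun x y => by
      have hx := (TwoSidedIdeal.mem_inf A).1 x.2
      have hy := (TwoSidedIdeal.mem_inf A).1 y.2
      have h1 := hom_add f x.1 y.1 hx.1 hy.1 (f.dom.add_mem hx.1 hy.1)
      have h2 := hom_add g x.1 y.1 hx.2 hy.2 (g.dom.add_mem hx.2 hy.2)
      exact (congrArg₂ (· + ·) h1 h2).trans (add_add_add_comm _ _ _ _))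
    (fun x hx a => by
      have hx' := (TwoSidedIdeal.mem_inf A).1 hx
      have h1 := hom_mul f x hx'.1 a (f.dom.mul_mem_right _ _ hx'.1)
      have h2 := hom_mul g x hx'.2 a (g.dom.mul_mem_right _ _ hx'.2)
      exact (congrArg₂ (· + ·) h1 h2).trans (add_mul _ _ _).symm)

/-- The pointwise negative. -/
def neg (f : IdealHom A) : IdealHom A where
  dom := f.dom
  dom_ne_bot := f.dom_ne_bot
  hom := mkHom f.dom (fun x => -f.hom x)
    (fun x y => by rw [map_add, neg_add])
    (fun x hx a => by rw [hom_mul f x hx, neg_mul])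

/-- The composite `x ↦ f (g x)`, on the largest two-sided ideal on which it is defined. -/
def comp (f g : IdealHom A) : IdealHom A where
  dom := g.pre f.dom
  dom_ne_bot := pre_ne_bot g f.dom_ne_bot
  hom := mkHom (g.pre f.dom)
    (fun x => f.hom ⟨g.hom ⟨x.1, (exists_of_mem_pre x.2).1⟩, (exists_of_mem_pre x.2).2⟩)
    (fun x y => by
      obtain ⟨h1, h2⟩ := exists_of_mem_pre x.2
      obtain ⟨h3, h4⟩ := exists_of_mem_pre y.2
      rw [← hom_add f _ _ h2 h4 (f.dom.add_mem h2 h4)]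
      congr 2
      exact hom_add g _ _ h1 h3 (g.dom.add_mem h1 h3))
    (fun x hx a => by
      obtain ⟨h1, h2⟩ := exists_of_mem_pre hx
      rw [← hom_mul f _ h2 a (f.dom.mul_mem_right _ _ h2)]
      congr 2
      exact hom_mul g _ h1 a (g.dom.mul_mem_right _ _ h1))

theorem add_rel {f f' g g' : IdealHom A} (hf : Rel f f') (hg : Rel g g') :
    Rel (f.add g) (f'.add g') := by
  obtain ⟨J, hJ, h⟩ := hf
  obtain ⟨L, hL, h'⟩ := hg
  refine ⟨J ⊓ L, inf_ne_bot hJ hL, fun x hx => ?_⟩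
  obtain ⟨h1, h2, h3⟩ := h x ((TwoSidedIdeal.mem_inf A).1 hx).1
  obtain ⟨h4, h5, h6⟩ := h' x ((TwoSidedIdeal.mem_inf A).1 hx).2
  exact ⟨(TwoSidedIdeal.mem_inf A).2 ⟨h1, h4⟩, (TwoSidedIdeal.mem_inf A).2 ⟨h2, h5⟩,
    congrArg₂ (· + ·) h3 h6⟩

theorem neg_rel {f f' : IdealHom A} (hf : Rel f f') : Rel f.neg f'.neg := by
  obtain ⟨J, hJ, h⟩ := hf
  refine ⟨J, hJ, fun x hx => ?_⟩
  obtain ⟨h1, h2, h3⟩ := h x hx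
  exact ⟨h1, h2, congrArg (- ·) h3⟩

theorem comp_rel {f f' g g' : IdealHom A} (hf : Rel f f') (hg : Rel g g') :
    Rel (f.comp g) (f'.comp g') := by
  obtain ⟨J, hJ, h⟩ := hf
  obtain ⟨L, hL, h'⟩ := hg
  refine ⟨(g.pre J ⊓ L) ⊓ (g.pre f.dom ⊓ g'.pre f'.dom),
    inf_ne_bot (inf_ne_bot (pre_ne_bot g hJ) hL)
      (inf_ne_bot (pre_ne_bot g f.dom_ne_bot) (pre_ne_bot g' f'.dom_ne_bot)), fun x hx => ?_⟩
  simp only [TwoSidedIdeal.mem_inf] at hx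
  obtain ⟨⟨hx1, hx2⟩, hx3, hx4⟩ := hx
  refine ⟨hx3, hx4, ?_⟩
  obtain ⟨h1, h2⟩ := exists_of_mem_pre hx1
  obtain ⟨h3, h4, h5⟩ := h _ h2
  obtain ⟨h6, h7, h8⟩ := h' x hx2
  refine h5.trans ?_
  change f'.hom _ = f'.hom _
  congr 2

end IdealHom

/-- The (right) Martindale ring of quotients of a prime ring `A`: right `A`-module homomorphisms
`I → A` with `I` a nonzero two-sided ideal, up to agreement on a nonzero ideal. -/
def MartindaleQuotient (A : Type*) [Ring A] [IsPrimeRing A] : Type _ :=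
  Quotient (IdealHom.setoid A)

namespace MartindaleQuotient

open IdealHom

variable {A : Type*} [Ring A] [IsPrimeRing A]

/-- The class of a homomorphism. -/
def mk (f : IdealHom A) : MartindaleQuotient A := Quotient.mk (IdealHom.setoid A) f

theorem mk_eq_of {f g : IdealHom A} (h : ∀ x hf hg, f.hom ⟨x, hf⟩ = g.hom ⟨x, hg⟩) :
    mk f = mk g :=
  Quotient.sound (s := IdealHom.setoid A) (Rel.of_eq h)

instance : Zero (MartindaleQuotient A) := ⟨mk (lmul 0)⟩
instance : One (MartindaleQuotient A) := ⟨mk (lmul 1)⟩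
instance : Add (MartindaleQuotient A) :=
  ⟨Quotient.map₂ IdealHom.add fun _ _ h _ _ h' => add_rel h h'⟩
instance : Neg (MartindaleQuotient A) := ⟨Quotient.map IdealHom.neg fun _ _ h => neg_rel h⟩
instance : Mul (MartindaleQuotient A) :=
  ⟨Quotient.map₂ IdealHom.comp fun _ _ h _ _ h' => comp_rel h h'⟩

/-- Addition is pointwise and multiplication is composition. -/
instance : Ring (MartindaleQuotient A) where
  add_assoc := by
    rintro ⟨f⟩ ⟨g⟩ ⟨h⟩
    exact mk_eq_of fun x _ _ => add_assoc _ _ _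
  zero_add := by
    rintro ⟨f⟩
    refine mk_eq_of fun x h1 h2 => ?_
    change 0 * x + f.hom ⟨x, h2⟩ = _
    rw [zero_mul, zero_add]
  add_zero := by
    rintro ⟨f⟩
    refine mk_eq_of fun x h1 h2 => ?_
    change f.hom ⟨x, h2⟩ + 0 * x = _
    rw [zero_mul, add_zero]
  add_comm := by
    rintro ⟨f⟩ ⟨g⟩
    exact mk_eq_of fun x _ _ => add_comm _ _
  nsmul := nsmulRec
  zsmul := zsmulRec
  neg_add_cancel := by
    rintro ⟨f⟩
    refine mk_eq_of fun x h1 h2 => ?_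
    change -f.hom ⟨x, _⟩ + f.hom ⟨x, _⟩ = 0 * x
    rw [zero_mul, neg_add_cancel]
  mul_assoc := by
    rintro ⟨f⟩ ⟨g⟩ ⟨h⟩
    exact mk_eq_of fun x _ _ => rfl
  one_mul := by
    rintro ⟨f⟩
    refine mk_eq_of fun x h1 h2 => ?_
    change 1 * f.hom ⟨x, _⟩ = _
    rw [one_mul]
  mul_one := by
    rintro ⟨f⟩
    refine mk_eq_of fun x h1 h2 => ?_
    change f.hom ⟨1 * x, _⟩ = f.hom ⟨x, _⟩
    congr 2
    rw [one_mul]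
  zero_mul := by
    rintro ⟨f⟩
    refine mk_eq_of fun x h1 h2 => ?_
    change 0 * f.hom ⟨x, _⟩ = 0 * x
    rw [zero_mul, zero_mul]
  mul_zero := by
    rintro ⟨f⟩
    refine mk_eq_of fun x h1 h2 => ?_
    change f.hom ⟨0 * x, _⟩ = 0 * x
    refine Eq.trans ?_ (zero_mul x).symm
    exact (congrArg f.hom (Subtype.ext (zero_mul x))).trans f.hom.map_zero
  left_distrib := by
    rintro ⟨f⟩ ⟨g⟩ ⟨h⟩
    refine mk_eq_of fun x h1 h2 => ?_
    exact hom_add f _ _ _ _ _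
  right_distrib := by
    rintro ⟨f⟩ ⟨g⟩ ⟨h⟩
    exact mk_eq_of fun x _ _ => rfl

/-- The canonical map `A → Q(A)`, `a ↦ (x ↦ a x)`. -/
def of : A →+* MartindaleQuotient A where
  toFun a := mk (lmul a)
  map_one' := rfl
  map_zero' := rfl
  map_mul' a b := mk_eq_of fun x _ _ => mul_assoc a b x
  map_add' a b := mk_eq_of fun x _ _ => add_mul a b x

/-- If `A` is a `K`-algebra, so is its Martindale ring of quotients, through `K → A → Q(A)`. -/
instance {K : Type*} [CommSemiring K] [Algebra K A] : Algebra K (MartindaleQuotient A) :=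
  RingHom.toAlgebra' (of.comp (algebraMap K A)) (by
    rintro k ⟨f⟩
    refine mk_eq_of fun x h1 h2 => ?_
    change algebraMap K A k * f.hom ⟨x, _⟩ = f.hom ⟨algebraMap K A k * x, _⟩
    have hx : x ∈ f.dom := (exists_of_mem_pre h1).1
    have e : (⟨algebraMap K A k * x, f.dom.mul_mem_left _ _ hx⟩ : f.dom) =
        ⟨x * algebraMap K A k, f.dom.mul_mem_right _ _ hx⟩ :=
      Subtype.ext (Algebra.commutes k x)
    exact (Algebra.commutes k _).trans
      ((hom_mul f x hx _ _).symm.trans (congrArg f.hom e.symm)))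

end MartindaleQuotient

/-- The extended centre of a prime `K`-algebra: the centre of its Martindale ring of quotients. -/
abbrev extendedCentre (K A : Type*) [Field K] [Ring A] [IsPrimeRing A] [Algebra K A] :
    Subalgebra K (MartindaleQuotient A) :=
  Subalgebra.center K (MartindaleQuotient A)

/-! Suppose the extended centre `L` contains an element `z` transcendental over `K`. Let `B = LA` be
the `L`-subalgebra of the Martindale ring of quotients generated by `A`, let `V` be a frame of `A`
and `W = LV`. Then `B` is a prime `L`-algebra with frame `W`, and since `A ⊆ B` it suffices to find
a standard identity for `B`. This is immediate if `B` is finite dimensional over `L`; assume it is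
not.

By `exists_satisfiesStandard_or_sq_le_finrank`, either `B` satisfies a standard identity or `dim_L
W^(an) ≥ n²` for some `a`. Indeed, slow growth forces an infinite word of normal monomials with few
factors, hence an eventually periodic one (Morse–Hedlund). So `B` acts faithfully on the product of
finitely many generic fibres `L(X) ⊗ B`, where `X` acts as right multiplication by a possible
period. If all fibres are finite dimensional, an identity follows; an infinite dimensional fibre
yields quadratic growth.

Quadratic growth over `L` is excluded by `false_of_transcendental`. Elements of `L` have
denominators in `A`, so there are elements `e ≠ 0` with `e, ze, …, zᵀe` in `A`; by
`mul_finrank_span_le` the `L`-dimension of `eWⁿ` is then `T + 1` times smaller than a `K`-dimension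
that is quadratic in `n`. The number of terms in a direct sum of nonzero left ideals is at most some
`u` independent of `T` (`exists_bound_directLeftIdeals`). A longest family of such `e_i` generating
independent left ideals has no common right annihilator, so `W^(am)` embeds in the product of at
most `u` spaces `e_i W^(am)`. This bounds `m²` by `u C (1 + a)² m² / (T + 1)`, which is absurd for
large `T`. -/

open Module

/-! ### Standard identities -/

/-- The standard identity of degree `n` holds in `B`. -/
def SatisfiesStandard (n : ℕ) (B : Type*) [Ring B] : Prop :=
  ∀ v : Fin n → B,
    ∑ σ : Equiv.Perm (Fin n), Equiv.Perm.sign σ • (List.ofFn fun i => v (σ i)).prod = 0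

theorem SatisfiesStandard.of_injective {n : ℕ} {B E : Type*} [Ring B] [Ring E]
    (h : SatisfiesStandard n E) (φ : B →+* E) (hφ : Function.Injective φ) :
    SatisfiesStandard n B := by
  intro v
  apply hφ
  rw [map_zero, map_sum, ← h (fun i => φ (v i))]
  refine Finset.sum_congr rfl fun σ _ => ?_
  rw [Units.smul_def, Units.smul_def, map_zsmul, map_list_prod, List.map_ofFn]
  rfl

/-- The standard polynomial is the alternatization of the product, and alternating maps vanish on
linearly dependent families. -/
theorem satisfiesStandard_of_finite (F E : Type*) [Field F] [Ring E] [Algebra F E]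
    [FiniteDimensional F E] : SatisfiesStandard (finrank F E + 1) E := by
  intro v
  have h := (MultilinearMap.alternatization
    (MultilinearMap.mkPiAlgebraFin F (finrank F E + 1) E)).map_linearDependent v (fun hv => by
      have := hv.fintype_card_le_finrank
      simp at this)
  rw [MultilinearMap.alternatization_apply] at h
  simpa using h

/-- Distinct permutations give distinct words, so the word of the identity permutation keeps
coefficient 1 and the standard polynomial is nonzero in every characteristic. -/
theorem SatisfiesStandard.isPIAlgebra {n : ℕ} {K A : Type*} [Field K] [Ring A] [Algebra K A]
    (h : SatisfiesStandard n A) : IsPIAlgebra K A := by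
  set p : FreeAlgebra K ℕ := ∑ σ : Equiv.Perm (Fin n),
    Equiv.Perm.sign σ • (List.ofFn fun i => FreeAlgebra.ι K (σ i : ℕ)).prod with hp
  have key : ∀ {B : Type _} [Ring B] [Algebra K B] (v : ℕ → B), FreeAlgebra.lift K v p =
      ∑ σ : Equiv.Perm (Fin n),
        Equiv.Perm.sign σ • (List.ofFn fun i => v (σ i : ℕ)).prod := by
    intro B _ _ v
    rw [hp, map_sum]
    refine Finset.sum_congr rfl fun σ _ => ?_
    rw [Units.smul_def, Units.smul_def, map_zsmul, map_list_prod, List.map_ofFn]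
    congr 3
    ext i
    simp
  refine ⟨p, fun h0 => ?_, fun v => ?_⟩
  · have h1 := congrArg (FreeAlgebra.equivMonoidAlgebraFreeMonoid (R := K) (X := ℕ)) h0
    have h2 : ∀ l : List ℕ, (l.map fun i => FreeAlgebra.equivMonoidAlgebraFreeMonoid
        (FreeAlgebra.ι K i)).prod = MonoidAlgebra.single (FreeMonoid.ofList l) (1 : K) := by
      intro l
      induction l with
      | nil => rfl
      | cons a l ih =>
        rw [List.map_cons, List.prod_cons, ih]
        simp [FreeAlgebra.equivMonoidAlgebraFreeMonoid, MonoidAlgebra.of_apply,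
          MonoidAlgebra.single_mul_single, FreeMonoid.ofList_cons]
    have h3 : FreeAlgebra.equivMonoidAlgebraFreeMonoid p = ∑ σ : Equiv.Perm (Fin n),
        Equiv.Perm.sign σ • MonoidAlgebra.single
          (FreeMonoid.ofList (List.ofFn fun i => (σ i : ℕ))) (1 : K) := by
      rw [hp, map_sum]
      refine Finset.sum_congr rfl fun σ _ => ?_
      rw [Units.smul_def, Units.smul_def, map_zsmul, map_list_prod, ← h2]
      simp only [List.map_ofFn]
      rfl
    rw [h3, map_zero] at h1
    have h4 := congrArg (fun f : MonoidAlgebra K (FreeMonoid ℕ) =>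
      f.coeff (FreeMonoid.ofList (List.ofFn fun i : Fin n => (i : ℕ)))) h1
    simp only [MonoidAlgebra.coeff_sum, Finsupp.finsetSum_apply, Units.smul_def,
      MonoidAlgebra.coeff_smul, Finsupp.smul_apply, MonoidAlgebra.coeff_zero, Finsupp.zero_apply,
      MonoidAlgebra.coeff_single] at h4
    rw [Finset.sum_eq_single 1] at h4
    · simp at h4
    · intro σ _ hσ
      rw [Finsupp.single_eq_of_ne, smul_zero]
      intro he
      apply hσ
      have := List.ofFn_injective (FreeMonoid.ofList.injective he.symm)
      ext i
      exact congrFun this i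
    · simp
  · rw [key]
    exact h fun i => v i

/-! ### Dimension counts in linear algebra -/

/-- A chain of subspaces that starts off nonzero and increases strictly has dimension at least
`n + 1` at its `n`th member. -/
theorem lt_finrank_of_strict_chain {F M : Type*} [Field F] [AddCommGroup M] [Module F M]
    (U : ℕ → Submodule F M) (hfin : ∀ n, FiniteDimensional F (U n)) (h0 : U 0 ≠ ⊥)
    (hU : ∀ n, U n < U (n + 1)) (n : ℕ) : n < finrank F (U n) := by
  induction n with
  | zero =>
    have := hfin 0
    exact Nat.pos_of_ne_zero fun h => h0 (Submodule.finrank_eq_zero.1 h)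
  | succ n ih =>
    have := hfin (n + 1)
    have := Submodule.finrank_lt_finrank_of_lt (hU n)
    omega

/-- Rank and nullity for the restriction of a linear map to a subspace. -/
theorem finrank_add_finrank_map_le {F M N : Type*} [Field F] [AddCommGroup M] [Module F M]
    [AddCommGroup N] [Module F N] (f : M →ₗ[F] N) (P Q : Submodule F M)
    [FiniteDimensional F Q] (hPQ : P ≤ Q) (hP : ∀ x ∈ P, f x = 0) :
    finrank F P + finrank F (Q.map f) ≤ finrank F Q := by
  have h := (f.domRestrict Q).finrank_range_add_finrank_ker
  rw [LinearMap.range_domRestrict] at h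
  have h2 : finrank F P ≤ finrank F (LinearMap.ker (f.domRestrict Q)) := by
    refine LinearMap.finrank_le_finrank_of_injective
      (f := (Submodule.inclusion hPQ).codRestrict _ fun x => ?_) ?_
    · simp [LinearMap.mem_ker, hP x.1 x.2]
    · intro x y hxy
      have := congrArg (fun t => (t.1.1 : M)) hxy
      exact Subtype.ext this
  omega

/-! ### Frames of infinite dimensional prime algebras and one-sided annihilators -/

namespace IsFrame

variable {L B : Type*} [Field L] [Ring B] [Algebra L B] {W : Submodule L B}

theorem pow_mono (hW : IsFrame W) {m n : ℕ} (h : m ≤ n) : W ^ m ≤ W ^ n :=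
  pow_le_pow_right' (Submodule.one_le.2 hW.one_mem) h

theorem one_mem_pow (hW : IsFrame W) (n : ℕ) : (1 : B) ∈ W ^ n := by
  have := hW.pow_mono (Nat.zero_le n)
  rw [pow_zero] at this
  exact Submodule.one_le.1 this

theorem finite_pow (hW : IsFrame W) (n : ℕ) : FiniteDimensional L ↥(W ^ n) := by
  have := hW.finite
  exact Module.Finite.iff_fg.2 ((Module.Finite.iff_fg.1 this).pow n)

theorem mul_mem_pow {a b : B} {m n : ℕ} (ha : a ∈ W ^ m) (hb : b ∈ W ^ n) :
    a * b ∈ W ^ (m + n) := by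
  rw [pow_add]; exact Submodule.mul_mem_mul ha hb

theorem _root_.Submodule.exists_mem_pow_of_mem_adjoin (h1 : (1 : B) ∈ W) {b : B}
    (hb : b ∈ Algebra.adjoin L (W : Set B)) : ∃ n, b ∈ W ^ n := by
  have hmono : ∀ {m n : ℕ}, m ≤ n → W ^ m ≤ W ^ n :=
    fun h => pow_le_pow_right' (Submodule.one_le.2 h1) h
  induction hb using Algebra.adjoin_induction with
  | mem x hx => exact ⟨1, by simpa using hx⟩
  | algebraMap r =>
    exact ⟨0, by rw [pow_zero]; exact Submodule.algebraMap_mem r⟩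
  | add x y _ _ hx hy =>
    obtain ⟨m, hm⟩ := hx
    obtain ⟨n, hn⟩ := hy
    exact ⟨max m n, add_mem (hmono (le_max_left _ _) hm)
      (hmono (le_max_right _ _) hn)⟩
  | mul x y _ _ hx hy =>
    obtain ⟨m, hm⟩ := hx
    obtain ⟨n, hn⟩ := hy
    exact ⟨m + n, mul_mem_pow hm hn⟩

theorem exists_mem_pow (hW : IsFrame W) (b : B) : ∃ n, b ∈ W ^ n :=
  Submodule.exists_mem_pow_of_mem_adjoin hW.one_mem (hW.adjoin_eq_top ▸ trivial)

theorem exists_subset_pow (hW : IsFrame W) (s : Finset B) : ∃ n, ∀ b ∈ s, b ∈ W ^ n := by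
  choose f hf using hW.exists_mem_pow
  exact ⟨s.sup f, fun b hb => hW.pow_mono (Finset.le_sup hb) (hf b)⟩

/-- An infinite dimensional prime algebra has no nonzero finite dimensional right ideals, so the
subspaces `y Wⁿ` increase strictly. -/
theorem map_mulLeft_lt_succ [IsPrimeRing B] (hW : IsFrame W) (hB : ¬ FiniteDimensional L B)
    {y : B} (hy : y ≠ 0) (n : ℕ) : (W ^ n).map (LinearMap.mulLeft L y) <
      (W ^ (n + 1)).map (LinearMap.mulLeft L y) := by
  have hf := hW.finite_pow
  refine lt_of_le_of_ne (Submodule.map_mono (hW.pow_mono n.le_succ)) fun h => hB ?_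
  -- Once two consecutive members agree the chain is constant, so `yWⁿ = yB`.
  have hs : ∀ k, ∀ b ∈ W ^ (n + k), y * b ∈ (W ^ n).map (LinearMap.mulLeft L y) := by
    intro k
    induction k with
    | zero => exact fun b hb => ⟨b, hb, rfl⟩
    | succ k ih =>
      intro b hb
      rw [← add_assoc, pow_succ] at hb
      refine Submodule.mul_induction_on hb (fun c hc w hw => ?_) (fun c d hc hd => ?_)
      · obtain ⟨c', hc', he⟩ := ih c hc
        rw [h]
        refine ⟨c' * w, ?_, ?_⟩
        · rw [pow_succ]; exact Submodule.mul_mem_mul hc' hw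
        · change y * (c' * w) = _
          change y * c' = _ at he
          rw [← mul_assoc, he, mul_assoc]
      · rw [mul_add]; exact add_mem hc hd
  have hall : ∀ b, y * b ∈ (W ^ n).map (LinearMap.mulLeft L y) := fun b => by
    obtain ⟨k, hk⟩ := hW.exists_mem_pow b
    exact hs k b (hW.pow_mono (Nat.le_add_left k n) hk)
  have hstab : ∀ (p : (W ^ n).map (LinearMap.mulLeft L y)) (c : B),
      p.1 * c ∈ (W ^ n).map (LinearMap.mulLeft L y) := by
    rintro ⟨_, a, -, rfl⟩ c
    change y * a * c ∈ _
    rw [mul_assoc]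
    exact hall _
  -- `B` acts on the finite dimensional right ideal `yB` by right multiplication. Primeness makes
  -- the action faithful, so `B` itself is finite dimensional.
  let Φ : B →ₗ[L] (W ^ n).map (LinearMap.mulLeft L y) →ₗ[L]
      (W ^ n).map (LinearMap.mulLeft L y) :=
    LinearMap.mk₂ L (fun c p => ⟨p.1 * c, hstab p c⟩)
      (fun c d p => Subtype.ext (mul_add _ _ _))
      (fun r c p => Subtype.ext (mul_smul_comm _ _ _))
      (fun c p q => Subtype.ext (add_mul _ _ _))
      (fun r c p => Subtype.ext (smul_mul_assoc _ _ _))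
  refine Module.Finite.of_injective Φ ((injective_iff_map_eq_zero Φ).2 fun c hc => ?_)
  refine (IsPrimeRing.eq_zero_or_eq_zero y c fun r => ?_).resolve_left hy
  exact congrArg Subtype.val (LinearMap.congr_fun hc ⟨y * r, hall r⟩)

theorem lt_finrank_map_mulLeft [IsPrimeRing B] (hW : IsFrame W) (hB : ¬ FiniteDimensional L B)
    {y : B} (hy : y ≠ 0) (n : ℕ) :
    n < finrank L ((W ^ n).map (LinearMap.mulLeft L y)) := by
  have hf := hW.finite_pow
  refine lt_finrank_of_strict_chain (fun n => (W ^ n).map (LinearMap.mulLeft L y))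
    (fun n => inferInstance) ?_ (fun n => hW.map_mulLeft_lt_succ hB hy n) n
  · intro h
    refine hy ?_
    have : y * 1 ∈ (W ^ 0).map (LinearMap.mulLeft L y) := ⟨1, hW.one_mem_pow 0, rfl⟩
    rw [h] at this
    simpa using this

/-- The left-handed form of `map_mulLeft_lt_succ`. -/
theorem map_mulRight_lt_succ [IsPrimeRing B] (hW : IsFrame W) (hB : ¬ FiniteDimensional L B)
    {y : B} (hy : y ≠ 0) (n : ℕ) : (W ^ n).map (LinearMap.mulRight L y) <
      (W ^ (n + 1)).map (LinearMap.mulRight L y) := by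
  have hf := hW.finite_pow
  refine lt_of_le_of_ne (Submodule.map_mono (hW.pow_mono n.le_succ)) fun h => hB ?_
  have hs : ∀ k, ∀ b ∈ W ^ (n + k), b * y ∈ (W ^ n).map (LinearMap.mulRight L y) := by
    intro k
    induction k with
    | zero => exact fun b hb => ⟨b, hb, rfl⟩
    | succ k ih =>
      intro b hb
      rw [← add_assoc, pow_succ'] at hb
      refine Submodule.mul_induction_on hb (fun w hw c hc => ?_) (fun c d hc hd => ?_)
      · obtain ⟨c', hc', he⟩ := ih c hc
        rw [h]
        refine ⟨w * c', ?_, ?_⟩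
        · rw [pow_succ']; exact Submodule.mul_mem_mul hw hc'
        · change w * c' * y = _
          change c' * y = _ at he
          rw [mul_assoc, he, mul_assoc]
      · rw [add_mul]; exact add_mem hc hd
  have hall : ∀ b, b * y ∈ (W ^ n).map (LinearMap.mulRight L y) := fun b => by
    obtain ⟨k, hk⟩ := hW.exists_mem_pow b
    exact hs k b (hW.pow_mono (Nat.le_add_left k n) hk)
  have hstab : ∀ (p : (W ^ n).map (LinearMap.mulRight L y)) (c : B),
      c * p.1 ∈ (W ^ n).map (LinearMap.mulRight L y) := by
    rintro ⟨_, a, -, rfl⟩ c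
    change c * (a * y) ∈ _
    rw [← mul_assoc]
    exact hall _
  let Φ : B →ₗ[L] (W ^ n).map (LinearMap.mulRight L y) →ₗ[L]
      (W ^ n).map (LinearMap.mulRight L y) :=
    LinearMap.mk₂ L (fun c p => ⟨c * p.1, hstab p c⟩)
      (fun c d p => Subtype.ext (add_mul _ _ _))
      (fun r c p => Subtype.ext (smul_mul_assoc _ _ _))
      (fun c p q => Subtype.ext (mul_add _ _ _))
      (fun r c p => Subtype.ext (mul_smul_comm _ _ _))
  refine Module.Finite.of_injective Φ ((injective_iff_map_eq_zero Φ).2 fun c hc => ?_)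
  refine (IsPrimeRing.eq_zero_or_eq_zero c y fun r => ?_).resolve_right hy
  exact (mul_assoc c r y).trans
    (congrArg Subtype.val (LinearMap.congr_fun hc ⟨r * y, hall r⟩))

theorem lt_finrank_map_mulRight [IsPrimeRing B] (hW : IsFrame W) (hB : ¬ FiniteDimensional L B)
    {y : B} (hy : y ≠ 0) (n : ℕ) :
    n < finrank L ((W ^ n).map (LinearMap.mulRight L y)) := by
  have hf := hW.finite_pow
  refine lt_finrank_of_strict_chain (fun n => (W ^ n).map (LinearMap.mulRight L y))
    (fun n => inferInstance) ?_ (fun n => hW.map_mulRight_lt_succ hB hy n) n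
  · intro h
    refine hy ?_
    have : 1 * y ∈ (W ^ 0).map (LinearMap.mulRight L y) := ⟨1, hW.one_mem_pow 0, rfl⟩
    rw [h] at this
    simpa using this

/-- If `Wⁿ x Wⁿ` has dimension less than `(n + 1)²`, then `Wⁿ x` has zero left annihilator. -/
theorem eq_zero_of_forall_mul_mul_eq_zero_left [IsPrimeRing B] (hW : IsFrame W)
    (hB : ¬ FiniteDimensional L B) {x : B} (hx : x ≠ 0) {n : ℕ}
    (hn : finrank L ↥(W ^ n * Submodule.span L {x} * W ^ n) < (n + 1) ^ 2) {b : B}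
    (hb : ∀ w ∈ W ^ n, b * w * x = 0) : b = 0 := by
  by_contra hb0
  have hfin : ∀ i j : ℕ, FiniteDimensional L ↥(W ^ i * Submodule.span L {x} * W ^ j) := fun i j => by
    have h1 := Module.Finite.iff_fg.1 (hW.finite_pow i)
    have h2 := Module.Finite.iff_fg.1 (hW.finite_pow j)
    exact Module.Finite.iff_fg.2 ((h1.mul (Submodule.fg_span_singleton x)).mul h2)
  have hmem : ∀ {i j : ℕ} {a c : B}, a ∈ W ^ i → c ∈ W ^ j → a * x * c ∈ W ^ i * Submodule.span L {x} * W ^ j :=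
    fun ha hc => Submodule.mul_mem_mul
      (Submodule.mul_mem_mul ha (Submodule.mem_span_singleton_self x)) hc
  have hex : ∃ j, ∃ w ∈ W ^ j, b * w * x ≠ 0 := by
    by_contra hc
    push Not at hc
    rcases IsPrimeRing.eq_zero_or_eq_zero b x (fun r => by
      obtain ⟨j, hj⟩ := hW.exists_mem_pow r
      exact hc j r hj) with h | h
    · exact hb0 h
    · exact hx h
  classical
  obtain ⟨w, hw, hw0⟩ := Nat.find_spec hex
  have hmin : ∀ i < Nat.find hex, ∀ w ∈ W ^ i, b * w * x = 0 := fun i hi w hw => by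
    by_contra h
    exact Nat.find_min hex hi ⟨w, hw, h⟩
  have hlt : n < Nat.find hex := by
    by_contra h
    exact hw0 (hb w (hW.pow_mono (not_lt.1 h) hw))
  -- Let `j > n` be least with `b Wʲ x ≠ 0`. Some `c = bv`, `v ∈ W^(j-k-1)`, kills `Wᵏ x` but not
  -- `Wᵏ⁺¹ x`. Left multiplication by `c` kills `Wᵏ x Wⁿ`, while its image of `Wᵏ⁺¹ x Wⁿ` contains
  -- some nonzero element times `Wⁿ`. So each step in `k` adds at least `n + 1` dimensions.
  have key : ∀ k ≤ n, (k + 1) * (n + 1) ≤ finrank L ↥(W ^ k * Submodule.span L {x} * W ^ n) := by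
    intro k
    induction k with
    | zero =>
      intro _
      have h1 := hW.lt_finrank_map_mulLeft hB hx n
      have h2 : (W ^ n).map (LinearMap.mulLeft L x) ≤ W ^ 0 * Submodule.span L {x} * W ^ n := by
        rintro _ ⟨c, hc, rfl⟩
        have := hmem (hW.one_mem_pow 0) hc
        rwa [one_mul] at this
      have := hfin 0 n
      have := Submodule.finrank_mono h2
      omega
    | succ k ih =>
      intro hk
      obtain ⟨c, hc, u, hu, hcu⟩ : ∃ c : B, (∀ w ∈ W ^ k, c * w * x = 0) ∧
          ∃ u ∈ W ^ (k + 1), c * u * x ≠ 0 := by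
        by_contra hcon
        push Not at hcon
        obtain ⟨i, hi⟩ : ∃ i, Nat.find hex = i + (k + 1) :=
          ⟨Nat.find hex - (k + 1), by omega⟩
        apply hw0
        rw [hi, pow_add] at hw
        refine Submodule.mul_induction_on hw (fun v hv u hu => ?_) (fun c d hc hd => ?_)
        · rw [← mul_assoc b v u]
          refine hcon (b * v) (fun w hw => ?_) u hu
          rw [mul_assoc b v w]
          exact hmin (i + k) (by omega) _ (mul_mem_pow hv hw)
        · rw [mul_add, add_mul, hc, hd, add_zero]
      have h1 := hfin (k + 1) n
      have h2 := finrank_add_finrank_map_le (LinearMap.mulLeft L c) (W ^ k * Submodule.span L {x} * W ^ n)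
        (W ^ (k + 1) * Submodule.span L {x} * W ^ n)
        (mul_le_mul' (mul_le_mul' (hW.pow_mono k.le_succ) le_rfl) le_rfl)
        (fun y hy => by
          refine Submodule.mul_induction_on hy (fun p hp q hq => ?_) (fun p q hp hq => ?_)
          · obtain ⟨p', hp', t, ht, rfl⟩ : ∃ p' ∈ W ^ k, ∃ y, y = x ∧ p = p' * y := by
              obtain ⟨p', hp', rfl⟩ := Submodule.mem_mul_span_singleton.1 hp
              exact ⟨p', hp', x, rfl, rfl⟩
            subst ht
            change c * (p' * t * q) = 0
            rw [← mul_assoc, ← mul_assoc, hc p' hp', zero_mul]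
          · rw [map_add, hp, hq, add_zero])
      have h3 := hW.lt_finrank_map_mulLeft hB hcu n
      have h4 : (W ^ n).map (LinearMap.mulLeft L (c * u * x)) ≤
          (W ^ (k + 1) * Submodule.span L {x} * W ^ n).map (LinearMap.mulLeft L c) := by
        rintro _ ⟨v, hv, rfl⟩
        exact ⟨u * x * v, hmem hu hv, by simp [mul_assoc]⟩
      have h5 := Submodule.finrank_mono h4
      have := ih (by omega)
      have e : (k + 1 + 1) * (n + 1) = (k + 1) * (n + 1) + (n + 1) := by ring
      omega
  have := key n le_rfl
  rw [sq] at hn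
  omega

/-- If `Wⁿ x Wⁿ` has dimension less than `(n + 1)²`, then `x Wⁿ` has zero right annihilator. -/
theorem eq_zero_of_forall_mul_mul_eq_zero_right [IsPrimeRing B] (hW : IsFrame W)
    (hB : ¬ FiniteDimensional L B) {x : B} (hx : x ≠ 0) {n : ℕ}
    (hn : finrank L ↥(W ^ n * Submodule.span L {x} * W ^ n) < (n + 1) ^ 2) {b : B}
    (hb : ∀ w ∈ W ^ n, x * w * b = 0) : b = 0 := by
  by_contra hb0
  have hfin : ∀ i j : ℕ, FiniteDimensional L ↥(W ^ i * Submodule.span L {x} * W ^ j) := fun i j => by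
    have h1 := Module.Finite.iff_fg.1 (hW.finite_pow i)
    have h2 := Module.Finite.iff_fg.1 (hW.finite_pow j)
    exact Module.Finite.iff_fg.2 ((h1.mul (Submodule.fg_span_singleton x)).mul h2)
  have hmem : ∀ {i j : ℕ} {a c : B}, a ∈ W ^ i → c ∈ W ^ j → a * x * c ∈ W ^ i * Submodule.span L {x} * W ^ j :=
    fun ha hc => Submodule.mul_mem_mul
      (Submodule.mul_mem_mul ha (Submodule.mem_span_singleton_self x)) hc
  have hex : ∃ j, ∃ w ∈ W ^ j, x * w * b ≠ 0 := by
    by_contra hc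
    push Not at hc
    rcases IsPrimeRing.eq_zero_or_eq_zero x b (fun r => by
      obtain ⟨j, hj⟩ := hW.exists_mem_pow r
      exact hc j r hj) with h | h
    · exact hx h
    · exact hb0 h
  classical
  obtain ⟨w, hw, hw0⟩ := Nat.find_spec hex
  have hmin : ∀ i < Nat.find hex, ∀ w ∈ W ^ i, x * w * b = 0 := fun i hi w hw => by
    by_contra h
    exact Nat.find_min hex hi ⟨w, hw, h⟩
  have hlt : n < Nat.find hex := by
    by_contra h
    exact hw0 (hb w (hW.pow_mono (not_lt.1 h) hw))
  have key : ∀ k ≤ n, (k + 1) * (n + 1) ≤ finrank L ↥(W ^ n * Submodule.span L {x} * W ^ k) := by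
    intro k
    induction k with
    | zero =>
      intro _
      have h1 := hW.lt_finrank_map_mulRight hB hx n
      have h2 : (W ^ n).map (LinearMap.mulRight L x) ≤ W ^ n * Submodule.span L {x} * W ^ 0 := by
        rintro _ ⟨c, hc, rfl⟩
        have := hmem hc (hW.one_mem_pow 0)
        rwa [mul_one] at this
      have := hfin n 0
      have := Submodule.finrank_mono h2
      omega
    | succ k ih =>
      intro hk
      obtain ⟨c, hc, u, hu, hcu⟩ : ∃ c : B, (∀ w ∈ W ^ k, x * w * c = 0) ∧
          ∃ u ∈ W ^ (k + 1), x * u * c ≠ 0 := by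
        by_contra hcon
        push Not at hcon
        obtain ⟨i, hi⟩ : ∃ i, Nat.find hex = k + 1 + i :=
          ⟨Nat.find hex - (k + 1), by omega⟩
        apply hw0
        rw [hi, pow_add] at hw
        refine Submodule.mul_induction_on hw (fun u hu v hv => ?_) (fun c d hc hd => ?_)
        · rw [← mul_assoc x u v, mul_assoc (x * u) v b]
          refine hcon (v * b) (fun w hw => ?_) u hu
          rw [← mul_assoc, mul_assoc x w v]
          exact hmin (k + i) (by omega) _ (mul_mem_pow hw hv)
        · rw [mul_add, add_mul, hc, hd, add_zero]
      have h1 := hfin n (k + 1)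
      have h2 := finrank_add_finrank_map_le (LinearMap.mulRight L c) (W ^ n * Submodule.span L {x} * W ^ k)
        (W ^ n * Submodule.span L {x} * W ^ (k + 1))
        (mul_le_mul' le_rfl (hW.pow_mono k.le_succ))
        (fun y hy => by
          refine Submodule.mul_induction_on hy (fun p hp q hq => ?_) (fun p q hp hq => ?_)
          · obtain ⟨p', hp', t, ht, rfl⟩ : ∃ p' ∈ W ^ n, ∃ y, y = x ∧ p = p' * y := by
              obtain ⟨p', hp', rfl⟩ := Submodule.mem_mul_span_singleton.1 hp
              exact ⟨p', hp', x, rfl, rfl⟩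
            subst ht
            change p' * t * q * c = 0
            rw [mul_assoc, mul_assoc, ← mul_assoc t, hc q hq, mul_zero]
          · rw [map_add, hp, hq, add_zero])
      have h3 := hW.lt_finrank_map_mulRight hB hcu n
      have h4 : (W ^ n).map (LinearMap.mulRight L (x * u * c)) ≤
          (W ^ n * Submodule.span L {x} * W ^ (k + 1)).map (LinearMap.mulRight L c) := by
        rintro _ ⟨v, hv, rfl⟩
        exact ⟨v * x * u, hmem hv hu, by simp [mul_assoc]⟩
      have h5 := Submodule.finrank_mono h4
      have := ih (by omega)
      have e : (k + 1 + 1) * (n + 1) = (k + 1) * (n + 1) + (n + 1) := by ring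
      omega
  have := key n le_rfl
  rw [sq] at hn
  omega

end IsFrame

/-! ### Comparing dimensions over `K` and over `L`; denominators -/

section Transcendental

variable {K L B : Type*} [Field K] [Field L] [Algebra K L] [Ring B] [Algebra K B] [Algebra L B]
  [IsScalarTower K L B] {z : L}

theorem linearIndependent_pow_of_transcendental (hz : Transcendental K z) :
    LinearIndependent K fun i : ℕ => z ^ i := by
  have h := (Polynomial.basisMonomials K).linearIndependent.map'
    (Polynomial.aeval z).toLinearMap
    (LinearMap.ker_eq_bot.2 (transcendental_iff_injective.1 hz))
  convert! h using 1
  ext i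
  simp

/-- If `g, z g, …, zᵀ g` lie in `P` for all `g ∈ G`, then `P` is at least `T + 1` times as large
as the `L`-span of `G`. -/
theorem mul_finrank_span_le (hz : Transcendental K z) (T : ℕ) (G : Set B) (P : Submodule K B)
    [FiniteDimensional K P] (hG : ∀ g ∈ G, ∀ i ≤ T, z ^ i • g ∈ P) :
    (T + 1) * finrank L (Submodule.span L G) ≤ finrank K P := by
  -- With an `L`-basis of the span taken from `G` itself, the products of `1, z, …, zᵀ` with the
  -- basis are `K`-independent elements of `P`.
  obtain ⟨b, hbG, hspan, hli⟩ := exists_linearIndependent L G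
  have h1 : LinearIndependent K fun i : Fin (T + 1) => z ^ (i : ℕ) :=
    (linearIndependent_pow_of_transcendental hz).comp _ Fin.val_injective
  have h2 := linearIndependent_smul h1 hli
  let f : Fin (T + 1) × b → P :=
    fun p => ⟨z ^ (p.1 : ℕ) • p.2.1, hG _ (hbG p.2.2) _ (Nat.lt_succ_iff.1 p.1.2)⟩
  have h3 : LinearIndependent K f := LinearIndependent.of_comp P.subtype h2
  have : Finite (Fin (T + 1) × b) := h3.finite
  have : Finite b := Finite.of_injective (fun x : b => ((0 : Fin (T + 1)), x))
    fun x y h => (Prod.ext_iff.1 h).2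
  have := Fintype.ofFinite b
  have h4 := h3.fintype_card_le_finrank
  have h5 := finrank_span_eq_card hli
  rw [Subtype.range_coe, hspan] at h5
  rw [h5]
  simpa using h4

variable (L) in
open scoped Pointwise in
theorem span_pow_eq (V : Submodule K B) (n : ℕ) :
    Submodule.span L (V : Set B) ^ n = Submodule.span L ((V ^ n : Submodule K B) : Set B) := by
  rw [Submodule.span_pow]
  refine le_antisymm (Submodule.span_mono V.pow_subset_pow) (Submodule.span_le.2 fun x hx => ?_)
  have h : V ^ n = Submodule.span K ((V : Set B) ^ n) := by
    rw [← Submodule.span_pow, Submodule.span_eq]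
  rw [h] at hx
  exact Submodule.span_subset_span K L _ hx

/-- Scalars are central, so the middle factor absorbs the powers of `z` for the whole product. The
growth of `V` over `K` bounds dimensions over `L` through this inequality. -/
theorem mul_finrank_mul_span_mul_le (hz : Transcendental K z) {V : Submodule K B}
    (hVf : ∀ n, FiniteDimensional K ↥(V ^ n)) {T m : ℕ} {X : Set B}
    (hX : ∀ x ∈ X, ∀ i ≤ T, z ^ i • x ∈ V ^ m) (a b : ℕ) :
    (T + 1) * finrank L ↥(Submodule.span L (V : Set B) ^ a * Submodule.span L X *
      Submodule.span L (V : Set B) ^ b) ≤ finrank K ↥(V ^ (a + m + b)) := by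
  rw [span_pow_eq, span_pow_eq, Submodule.span_mul_span, Submodule.span_mul_span]
  refine mul_finrank_span_le hz T _ _ ?_
  rintro _ ⟨_, ⟨u, hu, x, hx, rfl⟩, v, hv, rfl⟩ i hi
  have : z ^ i • (u * x * v) = u * (z ^ i • x) * v := by
    rw [mul_smul_comm, smul_mul_assoc]
  change z ^ i • (u * x * v) ∈ _
  rw [this, pow_add, pow_add]
  exact Submodule.mul_mem_mul (Submodule.mul_mem_mul hu (hX x hx i hi)) hv

/-- The subalgebra `A` generated by `V` contains a common multiple for the coefficients in `L` of
any element of its `L`-span. -/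
theorem exists_denominator {V : Submodule K B} (hW : IsFrame (Submodule.span L (V : Set B)))
    (x : B) : ∃ F : Finset L, ∀ y : B, (∀ f ∈ F, f • y ∈ Algebra.adjoin K (V : Set B)) →
      ∀ r ∈ Algebra.adjoin K (V : Set B), x * r * y ∈ Algebra.adjoin K (V : Set B) ∧
        y * r * x ∈ Algebra.adjoin K (V : Set B) := by
  classical
  have hpow : ∀ n, ((V ^ n : Submodule K B) : Set B) ⊆ Algebra.adjoin K (V : Set B) := by
    exact fun n y hy => Submodule.pow_induction_on_left V
      (fun r => Subalgebra.algebraMap_mem _ r) (fun _ _ => add_mem)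
      (fun m hm x hx => mul_mem (Algebra.subset_adjoin hm) hx) hy
  obtain ⟨n, hn⟩ := hW.exists_mem_pow x
  rw [span_pow_eq] at hn
  -- For `x = Σ lᵢ vᵢ` with `vᵢ ∈ Vⁿ` the set of the `lᵢ` serves, because each `lᵢ` can be moved
  -- from `x` to `y`.
  induction hn using Submodule.span_induction with
  | mem x hx =>
    refine ⟨{1}, fun y hy r hr => ?_⟩
    have hy' := hy 1 (by simp)
    rw [one_smul] at hy'
    exact ⟨mul_mem (mul_mem (hpow n hx) hr) hy', mul_mem (mul_mem hy' hr) (hpow n hx)⟩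
  | zero => exact ⟨∅, fun y _ r _ => by simp [zero_mem]⟩
  | add x x' _ _ hx hx' =>
    obtain ⟨F, hF⟩ := hx
    obtain ⟨F', hF'⟩ := hx'
    refine ⟨F ∪ F', fun y hy r hr => ?_⟩
    obtain ⟨h1, h2⟩ := hF y (fun f hf => hy f (Finset.mem_union_left _ hf)) r hr
    obtain ⟨h3, h4⟩ := hF' y (fun f hf => hy f (Finset.mem_union_right _ hf)) r hr
    rw [add_mul, add_mul, mul_add]
    exact ⟨add_mem h1 h3, add_mem h2 h4⟩
  | smul l x _ hx =>
    obtain ⟨F, hF⟩ := hx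
    refine ⟨F.image (· * l), fun y hy r hr => ?_⟩
    have := hF (l • y) (fun f hf => by
      rw [smul_smul]; exact hy _ (Finset.mem_image_of_mem _ hf)) r hr
    simpa only [mul_smul_comm, smul_mul_assoc] using this

/-- Multiplying a nonzero `x` on either side by suitable elements, one gets a nonzero element
whose multiples by `1, z, …, zᵀ` lie in the subalgebra generated by `V`. -/
theorem exists_mul_ne_zero [IsPrimeRing B] {V : Submodule K B} (z : L)
    (hW : IsFrame (Submodule.span L (V : Set B)))
    (H : ∀ F : Finset L, ∃ y : B, y ≠ 0 ∧ ∀ f ∈ F, f • y ∈ Algebra.adjoin K (V : Set B))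
    {x : B} (hx : x ≠ 0) (T : ℕ) :
    (∃ y, x * y ≠ 0 ∧ ∀ i ≤ T, z ^ i • (x * y) ∈ Algebra.adjoin K (V : Set B)) ∧
    (∃ y, y * x ≠ 0 ∧ ∀ i ≤ T, z ^ i • (y * x) ∈ Algebra.adjoin K (V : Set B)) := by
  classical
  obtain ⟨F, hF⟩ := exists_denominator hW x
  -- The scalars `f zⁱ` are included so that every `zⁱ y` with `i ≤ T` can take the place of `y` in
  -- the property of `F`.
  obtain ⟨y, hy0, hy⟩ := H ((F ×ˢ Finset.range (T + 1)).image fun p => p.1 * z ^ p.2)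
  have key : ∀ i ≤ T, ∀ r ∈ Algebra.adjoin K (V : Set B),
      z ^ i • (x * r * y) ∈ Algebra.adjoin K (V : Set B) ∧
      z ^ i • (y * r * x) ∈ Algebra.adjoin K (V : Set B) := by
    intro i hi r hr
    have := hF (z ^ i • y) (fun f hf => by
      rw [smul_smul]
      exact hy _ (Finset.mem_image.2 ⟨(f, i), by simp [hf]; omega, rfl⟩)) r hr
    simpa only [mul_smul_comm, smul_mul_assoc] using this
  -- `key` only allows `r` in the `K`-subalgebra, whereas primeness of `B` tests all `r`; the
  -- subalgebra spans `B` over `L`, which closes the gap.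
  have hspan : ∀ φ : B →ₗ[L] B, (∀ r ∈ Algebra.adjoin K (V : Set B), φ r = 0) → φ = 0 := by
    intro φ hφ
    ext r
    have hr : r ∈ Submodule.span L (Algebra.adjoin K (V : Set B) : Set B) := by
      have h : Algebra.adjoin L (V : Set B) = ⊤ := by
        rw [← hW.adjoin_eq_top, Algebra.adjoin_span]
      have h2 : r ∈ Algebra.adjoin L (V : Set B) := h ▸ trivial
      rw [← Subalgebra.mem_toSubmodule, Algebra.adjoin_eq_span] at h2
      refine Submodule.span_mono ?_ h2
      exact show Submonoid.closure (V : Set B) ≤ (Algebra.adjoin K (V : Set B)).toSubmonoid from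
        Submonoid.closure_le.2 Algebra.subset_adjoin
    have : Submodule.span L (Algebra.adjoin K (V : Set B) : Set B) ≤ LinearMap.ker φ :=
      Submodule.span_le.2 hφ
    exact this hr
  constructor
  · by_contra hcon
    push Not at hcon
    have := hspan (LinearMap.mulLeft L x ∘ₗ LinearMap.mulRight L y) fun r hr => by
      by_contra h0
      obtain ⟨i, hi, h⟩ := hcon (r * y) h0
      exact h (by rw [← mul_assoc]; exact (key i hi r hr).1)
    rcases IsPrimeRing.eq_zero_or_eq_zero x y (fun r => by
      rw [mul_assoc]; exact LinearMap.congr_fun this r) with h | h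
    · exact hx h
    · exact hy0 h
  · by_contra hcon
    push Not at hcon
    have := hspan (LinearMap.mulLeft L y ∘ₗ LinearMap.mulRight L x) fun r hr => by
      by_contra h0
      have h0' : y * r * x ≠ 0 := by rw [mul_assoc]; exact h0
      obtain ⟨i, hi, h⟩ := hcon (y * r) h0'
      exact h (key i hi r hr).2
    rcases IsPrimeRing.eq_zero_or_eq_zero y x (fun r => by
      rw [mul_assoc]; exact LinearMap.congr_fun this r) with h | h
    · exact hy0 h
    · exact hx h

end Transcendental

/-! ### Direct sums of left ideals and the exclusion of quadratic growth over `L` -/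

/-- The left ideals generated by the `e i` are nonzero and their sum is direct. -/
structure DirectLeftIdeals {B : Type*} [Ring B] {k : ℕ} (e : Fin k → B) : Prop where
  ne_zero : ∀ i, e i ≠ 0
  independent : ∀ r : Fin k → B, ∑ i, r i * e i = 0 → ∀ i, r i * e i = 0

section

variable {K L B : Type*} [Field K] [Field L] [Ring B] [Algebra K B] [Algebra L B]
  {z : L} {V : Submodule K B}

theorem exists_forall_pow_smul_mem_pow (h1 : (1 : B) ∈ V) (T : ℕ) {x : B}
    (hx : ∀ i ≤ T, z ^ i • x ∈ Algebra.adjoin K (V : Set B)) :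
    ∃ m, ∀ n, m ≤ n → ∀ i ≤ T, z ^ i • x ∈ V ^ n := by
  choose! f hf using fun i hi => Submodule.exists_mem_pow_of_mem_adjoin h1 (hx i hi)
  refine ⟨(Finset.range (T + 1)).sup f, fun n hn i hi => ?_⟩
  exact pow_le_pow_right' (Submodule.one_le.2 h1)
    ((Finset.le_sup (f := f) (Finset.mem_range.2 (Nat.lt_succ_of_le hi))).trans hn) (hf i hi)

variable [Algebra K L] [IsScalarTower K L B]

/-- The dimension times `9C + 1` is at most `dim_K V^(3m) ≤ 9Cm²`. This makes the two annihilator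
criteria for `Wᵐ x Wᵐ` applicable. -/
theorem finrank_span_mul_lt (hz : Transcendental K z)
    (hVf : ∀ n, FiniteDimensional K ↥(V ^ n)) {C : ℕ}
    (hC : ∀ n, 1 ≤ n → finrank K ↥(V ^ n) ≤ C * n ^ 2) {x : B} {m : ℕ} (hm : 1 ≤ m)
    (hx : ∀ i ≤ 9 * C, z ^ i • x ∈ V ^ m) :
    finrank L ↥(Submodule.span L (V : Set B) ^ m * Submodule.span L {x} *
      Submodule.span L (V : Set B) ^ m) < (m + 1) ^ 2 := by
  have h1 := mul_finrank_mul_span_mul_le hz hVf (X := {x}) (T := 9 * C) (m := m)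
    (fun y hy i hi => by rw [Set.mem_singleton_iff.1 hy]; exact hx i hi) m m
  have h2 := hC (m + m + m) (by omega)
  by_contra hcon
  have h3 := Nat.mul_le_mul_left (9 * C + 1) (not_lt.1 hcon)
  have h4 : (9 * C + 1) * (m + 1) ^ 2 ≤ C * (m + m + m) ^ 2 := h3.trans (h1.trans h2)
  have h5 : (9 * C + 1) * (m + 1) ^ 2 = C * (m + m + m) ^ 2 + (18 * C * m + 9 * C + (m + 1) ^ 2) := by
    ring
  have h6 : 0 < (m + 1) ^ 2 := by positivity
  omega

variable [IsPrimeRing B]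

/-- The number of terms in a direct sum of nonzero left ideals is bounded. -/
theorem exists_bound_directLeftIdeals (hz : Transcendental K z) (hV1 : (1 : B) ∈ V)
    (hVf : ∀ n, FiniteDimensional K ↥(V ^ n)) (hW : IsFrame (Submodule.span L (V : Set B)))
    (hB : ¬ FiniteDimensional L B) {C : ℕ} (hC : ∀ n, 1 ≤ n → finrank K ↥(V ^ n) ≤ C * n ^ 2)
    (H : ∀ F : Finset L, ∃ y : B, y ≠ 0 ∧ ∀ f ∈ F, f • y ∈ Algebra.adjoin K (V : Set B)) :
    ∃ u : ℕ, ∀ (k : ℕ) (e : Fin k → B), DirectLeftIdeals e → k ≤ u := by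
  classical
  have hnt := IsPrimeRing.nontrivial (A := B)
  -- `9C` powers serve the annihilator criterion; the extra one guarantees that `zx` is covered even
  -- if `C = 0`.
  obtain ⟨⟨x, hx0, hx⟩, -⟩ := exists_mul_ne_zero z hW H (one_ne_zero (α := B)) (9 * C + 1)
  rw [one_mul] at hx0
  simp only [one_mul] at hx
  obtain ⟨m, hm⟩ := exists_forall_pow_smul_mem_pow hV1 _ hx
  replace hm := hm (m + 1) m.le_succ
  generalize hm' : m + 1 = m₁ at hm
  have hm1 : 1 ≤ m₁ := by omega
  have hann : ∀ b, (∀ w ∈ V ^ m₁, x * w * b = 0) → b = 0 := fun b hb =>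
    hW.eq_zero_of_forall_mul_mul_eq_zero_right hB hx0
      (finrank_span_mul_lt hz hVf hC hm1 fun i hi => hm i (by omega)) fun w hw => by
      rw [span_pow_eq] at hw
      have : Submodule.span L ((V ^ m₁ : Submodule K B) : Set B) ≤
          LinearMap.ker (LinearMap.mulRight L b ∘ₗ LinearMap.mulLeft L x) :=
        Submodule.span_le.2 hb
      exact this hw
  -- `Sⁿ` still has zero right annihilator and absorbs `n` powers of `z`, while its length in `V`
  -- grows only linearly with `n`.
  let S : Submodule K B := (V ^ m₁).map (LinearMap.mulLeft K x)
  have hSann : ∀ n b, (∀ s ∈ S ^ n, s * b = 0) → b = 0 := by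
    intro n
    induction n with
    | zero =>
      intro b hb
      simpa using hb 1 (by rw [pow_zero]; exact Submodule.one_le.1 le_rfl)
    | succ n ih =>
      intro b hb
      refine hann b fun w hw => ih _ fun s hs => ?_
      rw [← mul_assoc]
      refine hb _ ?_
      rw [pow_succ]
      exact Submodule.mul_mem_mul hs ⟨w, hw, rfl⟩
  have hSz : ∀ i ≤ 1, ∀ s ∈ S, z ^ i • s ∈ V ^ (2 * m₁) := by
    rintro i hi _ ⟨w, hw, rfl⟩
    change z ^ i • (x * w) ∈ _
    rw [← smul_mul_assoc, two_mul, pow_add]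
    exact Submodule.mul_mem_mul (hm i (by omega)) hw
  have hSn : ∀ n, ∀ s ∈ S ^ n, ∀ i ≤ n, z ^ i • s ∈ V ^ (2 * m₁ * n) := by
    intro n
    induction n with
    | zero =>
      intro s hs i hi
      obtain rfl : i = 0 := by omega
      rw [pow_zero, one_smul]
      simpa using hs
    | succ n ih =>
      intro s hs i hi
      rw [pow_succ] at hs
      rw [mul_add, mul_one, pow_add]
      refine Submodule.mul_induction_on hs (fun p hp q hq => ?_) (fun p q hp hq => ?_)
      · rcases Nat.lt_or_ge n i with h | h
        · obtain rfl : i = n + 1 := by omega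
          have : z ^ (n + 1) • (p * q) = (z ^ n • p) * (z ^ 1 • q) := by
            rw [smul_mul_smul_comm, pow_succ, pow_one]
          rw [this]
          exact Submodule.mul_mem_mul (ih p hp n le_rfl) (hSz 1 le_rfl q hq)
        · rw [← smul_mul_assoc]
          have := hSz 0 (by omega) q hq
          rw [pow_zero, one_smul] at this
          exact Submodule.mul_mem_mul (ih p hp i h) this
      · rw [smul_add]; exact add_mem hp hq
  -- With `n > c` the length `n + 2m₁n + c` is at most `(2m₁ + 2)n`. One factor `n + 1` comes from
  -- the powers of `z`, another from the dimension of each summand; together they cancel the `n²` of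
  -- the growth bound.
  refine ⟨C * (2 * m₁ + 2) ^ 2, fun k e he => ?_⟩
  obtain ⟨c, hc⟩ := hW.exists_subset_pow (Finset.univ.image e)
  set n := c + 1 with hn
  have hy : ∀ i, ∃ y ∈ S ^ n, y * e i ≠ 0 := fun i => by
    by_contra hcon
    push Not at hcon
    exact he.ne_zero i (hSann n _ hcon)
  choose y hyS hy0 using hy
  let W := Submodule.span L (V : Set B)
  have hle := mul_finrank_mul_span_mul_le hz hVf (X := ((S ^ n : Submodule K B) : Set B))
    (T := n) (hSn n) n c
  have hsub : ∀ i, (W ^ n).map (LinearMap.mulRight L (y i * e i)) ≤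
      W ^ n * Submodule.span L ((S ^ n : Submodule K B) : Set B) * W ^ c := by
    rintro i _ ⟨w, hw, rfl⟩
    change w * (y i * e i) ∈ _
    rw [← mul_assoc]
    exact Submodule.mul_mem_mul (Submodule.mul_mem_mul hw (Submodule.subset_span (hyS i)))
      (hc _ (Finset.mem_image_of_mem _ (Finset.mem_univ i)))
  have hfU : FiniteDimensional L
      ↥(W ^ n * Submodule.span L ((S ^ n : Submodule K B) : Set B) * W ^ c) := by
    have hSfg : (S ^ n).FG := ((Module.Finite.iff_fg.1 (hVf m₁)).map _).pow n
    obtain ⟨s, hs⟩ := hSfg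
    have : Submodule.span L ((S ^ n : Submodule K B) : Set B) = Submodule.span L (s : Set B) := by
      rw [← hs, Submodule.span_span_of_tower]
    rw [this]
    exact Module.Finite.iff_fg.2 (((Module.Finite.iff_fg.1 (hW.finite_pow n)).mul
      (Submodule.fg_span s.finite_toSet)).mul (Module.Finite.iff_fg.1 (hW.finite_pow c)))
  have hfW := hW.finite_pow n
  -- The spaces `Wⁿ yᵢ eᵢ` lie in the independent left ideals `B eᵢ`, so their sum is direct.
  let Φ : (∀ i, (W ^ n).map (LinearMap.mulRight L (y i * e i))) →ₗ[L]
      ↥(W ^ n * Submodule.span L ((S ^ n : Submodule K B) : Set B) * W ^ c) :=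
    LinearMap.lsum L (fun i => (W ^ n).map (LinearMap.mulRight L (y i * e i))) L
      fun i => Submodule.inclusion (hsub i)
  have hΦ : Function.Injective Φ := by
    refine (injective_iff_map_eq_zero Φ).2 fun g hg => ?_
    have hg' : ∑ i, (g i).1 = 0 := by
      have := congrArg Subtype.val hg
      simpa [Φ, LinearMap.lsum_apply] using this
    choose w hw hwg using fun i => (g i).2
    have : ∀ i, (g i).1 = w i * y i * e i := fun i => by
      rw [mul_assoc]; exact (hwg i).symm
    simp only [this] at hg'
    ext i
    rw [this, he.independent _ hg' i]
    rfl
  have h1 := LinearMap.finrank_le_finrank_of_injective hΦ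
  rw [Module.finrank_pi_fintype] at h1
  have h2 : k * (n + 1) ≤ ∑ i, finrank L ((W ^ n).map (LinearMap.mulRight L (y i * e i))) := by
    have := Finset.card_nsmul_le_sum Finset.univ
      (fun i => finrank L ((W ^ n).map (LinearMap.mulRight L (y i * e i)))) (n + 1)
      fun i _ => hW.lt_finrank_map_mulRight hB (hy0 i) n
    simpa using this
  have h3 := hC (n + 2 * m₁ * n + c) (by omega)
  have h4 : (n + 1) * (k * (n + 1)) ≤ C * ((2 * m₁ + 2) * n) ^ 2 := by
    refine ((Nat.mul_le_mul_left _ (h2.trans h1)).trans hle).trans (h3.trans ?_)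
    refine Nat.mul_le_mul_left _ (Nat.pow_le_pow_left ?_ 2)
    have : (2 * m₁ + 2) * n = n + 2 * m₁ * n + n := by ring
    omega
  have h5 : k * n ^ 2 ≤ C * (2 * m₁ + 2) ^ 2 * n ^ 2 := by
    calc k * n ^ 2 ≤ (n + 1) * (k * (n + 1)) := by nlinarith
      _ ≤ _ := h4
      _ = _ := by ring
  exact Nat.le_of_mul_le_mul_right h5 (by positivity)

/-- A prime algebra over `L` that grows at least quadratically has no order `A` over `K` of
quadratic growth if `L` is not algebraic over `K`. -/
theorem false_of_transcendental (hz : Transcendental K z) (hV1 : (1 : B) ∈ V)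
    (hVf : ∀ n, FiniteDimensional K ↥(V ^ n)) (hW : IsFrame (Submodule.span L (V : Set B)))
    (hB : ¬ FiniteDimensional L B) {C : ℕ} (hC : ∀ n, 1 ≤ n → finrank K ↥(V ^ n) ≤ C * n ^ 2)
    (H : ∀ F : Finset L, ∃ y : B, y ≠ 0 ∧ ∀ f ∈ F, f • y ∈ Algebra.adjoin K (V : Set B))
    {a : ℕ} (ha : ∀ n, n ^ 2 ≤ finrank L ↥(Submodule.span L (V : Set B) ^ (a * n))) : False := by
  classical
  obtain ⟨u, hu⟩ := exists_bound_directLeftIdeals hz hV1 hVf hW hB hC H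
  -- The final count gives `T + 1 ≤ u C (1 + a)²`, which this choice contradicts.
  set T := u * C * (1 + a) ^ 2 + 9 * C with hT
  let P : ℕ → Prop := fun k => ∃ e : Fin k → B, DirectLeftIdeals e ∧
    ∀ i, ∀ j ≤ T, z ^ j • e i ∈ Algebra.adjoin K (V : Set B)
  -- Lengths of direct families are bounded by `u`, so some family cannot be replaced by a longer
  -- one.
  obtain ⟨k, ⟨e, he, heA⟩, hk⟩ : ∃ k, P k ∧ ¬ P (k + 1) := by
    by_contra hcon
    push Not at hcon
    have hall : ∀ k, P k := fun k => by
      induction k with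
      | zero => exact ⟨Fin.elim0, ⟨fun i => i.elim0, fun _ _ i => i.elim0⟩, fun i => i.elim0⟩
      | succ k ih => exact hcon k ih
    obtain ⟨e, he, -⟩ := hall (u + 1)
    have := hu _ e he
    omega
  have hann : ∀ b, (∀ i, e i * b = 0) → b = 0 := by
    intro b hb
    by_contra hb0
    obtain ⟨⟨y, hx0, hx⟩, -⟩ := exists_mul_ne_zero z hW H hb0 (9 * C)
    have hex : ∀ i, e i * (b * y) = 0 := fun i => by rw [← mul_assoc, hb, zero_mul]
    generalize b * y = x at hx0 hx hex
    -- The left annihilator of `x` is essential. Otherwise a multiple `yc` could be adjoined to the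
    -- `eᵢ`: multiplying a relation on the right by `x` removes the terms in `eᵢ`, since `eᵢ x = 0`.
    have hess : ∀ c, c ≠ 0 → ∃ r, r * c ≠ 0 ∧ r * c * x = 0 := by
      intro c hc
      obtain ⟨-, y, hy0, hy⟩ := exists_mul_ne_zero z hW H hc T
      by_contra hcon
      push Not at hcon
      refine hk ⟨Fin.cons (y * c) e, ⟨Fin.cases hy0 he.ne_zero, fun r hr => ?_⟩,
        Fin.cases hy heA⟩
      rw [Fin.sum_univ_succ] at hr
      simp only [Fin.cons_zero, Fin.cons_succ] at hr
      have h0 : r 0 * (y * c) = 0 := by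
        by_contra h0
        refine hcon (r 0 * y) (by rwa [mul_assoc]) ?_
        rw [mul_assoc (r 0), eq_neg_of_add_eq_zero_left hr, neg_mul, Finset.sum_mul]
        simp [mul_assoc, hex]
      rw [h0, zero_add] at hr
      exact Fin.cases h0 fun i => he.independent _ hr i
    -- Essentiality applied one vector at a time yields `c ≠ 0` killing `v x` for finitely many `v`.
    -- For `v` spanning a power of `W` this contradicts the left annihilator criterion.
    have hfin : ∀ s : Finset B, ∃ c, c ≠ 0 ∧ ∀ v ∈ s, c * v * x = 0 := by
      intro s
      induction s using Finset.induction_on with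
      | empty =>
        have := IsPrimeRing.nontrivial (A := B)
        exact ⟨1, one_ne_zero, by simp⟩
      | insert v s _ ih =>
        obtain ⟨c, hc0, hc⟩ := ih
        by_cases hv : c * v = 0
        · refine ⟨c, hc0, fun v' hv' => ?_⟩
          rcases Finset.mem_insert.1 hv' with rfl | h
          · rw [hv, zero_mul]
          · exact hc _ h
        · obtain ⟨r, hr0, hr⟩ := hess _ hv
          refine ⟨r * c, fun h => hr0 (by rw [← mul_assoc, h, zero_mul]), fun v' hv' => ?_⟩
          rcases Finset.mem_insert.1 hv' with rfl | h
          · rw [mul_assoc r, hr]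
          · rw [mul_assoc r, mul_assoc r, hc _ h, mul_zero]
    obtain ⟨m, hm⟩ := exists_forall_pow_smul_mem_pow hV1 _ hx
    obtain ⟨s, hs⟩ := Module.Finite.iff_fg.1 (hW.finite_pow (m + 1))
    obtain ⟨c, hc0, hc⟩ := hfin s
    refine hc0 (hW.eq_zero_of_forall_mul_mul_eq_zero_left hB hx0
      (finrank_span_mul_lt hz hVf hC (Nat.le_add_left 1 m) (hm (m + 1) m.le_succ))
      fun w hw => ?_)
    rw [← hs] at hw
    have : Submodule.span L (s : Set B) ≤
        LinearMap.ker (LinearMap.mulRight L x ∘ₗ LinearMap.mulLeft L c) :=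
      Submodule.span_le.2 hc
    exact this hw
  choose f hf using fun i => exists_forall_pow_smul_mem_pow hV1 T (heA i)
  -- Positivity of `m` allows `m²` to be cancelled at the end.
  set m := Finset.univ.sup f + 1 with hm
  have hem : ∀ i, ∀ j ≤ T, z ^ j • e i ∈ V ^ m := fun i => hf i m
    ((Finset.le_sup (f := f) (Finset.mem_univ i)).trans (Nat.le_succ _))
  let W := Submodule.span L (V : Set B)
  have hfW := hW.finite_pow (a * m)
  -- Since no nonzero element is killed by all `eᵢ`, the map `w ↦ (eᵢ w)ᵢ` is injective.
  let Φ : ↥(W ^ (a * m)) →ₗ[L] ∀ i, (W ^ (a * m)).map (LinearMap.mulLeft L (e i)) :=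
    LinearMap.pi fun i => (LinearMap.mulLeft L (e i)).submoduleMap _
  have hΦ : Function.Injective Φ := by
    refine (injective_iff_map_eq_zero Φ).2 fun g hg => Subtype.ext (hann g.1 fun i => ?_)
    exact congrArg Subtype.val (congrFun hg i)
  have h1 := LinearMap.finrank_le_finrank_of_injective hΦ
  rw [Module.finrank_pi_fintype] at h1
  have h2 : ∀ i, (T + 1) * finrank L ((W ^ (a * m)).map (LinearMap.mulLeft L (e i))) ≤
      C * ((1 + a) * m) ^ 2 := by
    intro i
    have h3 := mul_finrank_mul_span_mul_le hz hVf (X := {e i}) (T := T) (m := m)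
      (fun y hy j hj => by rw [Set.mem_singleton_iff.1 hy]; exact hem i j hj) 0 (a * m)
    have h4 := hC (0 + m + a * m) (by omega)
    have e1 : 0 + m + a * m = (1 + a) * m := by ring
    rw [e1] at h3 h4
    refine le_trans (Nat.mul_le_mul_left _ ?_) (h3.trans h4)
    have hfin : FiniteDimensional L
        ↥(W ^ 0 * Submodule.span L {e i} * W ^ (a * m)) :=
      Module.Finite.iff_fg.2 (((Module.Finite.iff_fg.1 (hW.finite_pow 0)).mul
        (Submodule.fg_span_singleton _)).mul (Module.Finite.iff_fg.1 hfW))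
    refine Submodule.finrank_mono ?_
    rintro _ ⟨w, hw, rfl⟩
    rw [pow_zero, one_mul]
    exact Submodule.mul_mem_mul (Submodule.mem_span_singleton_self _) hw
  have h3 : (T + 1) * m ^ 2 ≤ u * (C * ((1 + a) * m) ^ 2) := by
    calc (T + 1) * m ^ 2
        ≤ (T + 1) * ∑ i, finrank L ((W ^ (a * m)).map (LinearMap.mulLeft L (e i))) :=
          Nat.mul_le_mul_left _ ((ha m).trans h1)
      _ = ∑ i, (T + 1) * finrank L ((W ^ (a * m)).map (LinearMap.mulLeft L (e i))) :=
          Finset.mul_sum _ _ _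
      _ ≤ ∑ _i : Fin k, C * ((1 + a) * m) ^ 2 := Finset.sum_le_sum fun i _ => h2 i
      _ = k * (C * ((1 + a) * m) ^ 2) := by simp
      _ ≤ _ := Nat.mul_le_mul_right _ (hu k e he)
  have h4 : (T + 1) * m ^ 2 ≤ u * C * (1 + a) ^ 2 * m ^ 2 := h3.trans_eq (by ring)
  have h5 := Nat.le_of_mul_le_mul_right h4 (by positivity)
  omega

end

/-! ### Infinite words: Kőnig's lemma and the Morse–Hedlund theorem -/

section Words

/-- The factor of length `m` at position `i` of an infinite word. -/
def wordFactor {α : Type*} (ω : ℕ → α) (i m : ℕ) : List α :=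
  (List.range m).map fun t => ω (i + t)

section
variable {α : Type*} (ω : ℕ → α)

@[simp]
theorem length_wordFactor (i m : ℕ) : (wordFactor ω i m).length = m := by simp [wordFactor]

theorem wordFactor_add (i m n : ℕ) :
    wordFactor ω i (m + n) = wordFactor ω i m ++ wordFactor ω (i + m) n := by
  simp [wordFactor, List.range_add, add_assoc]

theorem wordFactor_congr {i j n : ℕ} (h : wordFactor ω i n = wordFactor ω j n) {t : ℕ}
    (ht : t < n) : ω (i + t) = ω (j + t) := by
  have := List.map_inj_left.1 h t (List.mem_range.2 ht)
  exact this

theorem wordFactor_eq_of {i j n : ℕ} (h : ∀ t < n, ω (i + t) = ω (j + t)) :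
    wordFactor ω i n = wordFactor ω j n :=
  List.map_congr_left fun t ht => h t (List.mem_range.1 ht)

/-- Kőnig's lemma for words over a finite alphabet. -/
theorem exists_infinite_word [Finite α] (T : Set (List α))
    (hpre : ∀ a b : List α, a ++ b ∈ T → a ∈ T) (hT : ∀ n, ∃ w ∈ T, w.length = n) :
    ∃ ω : ℕ → α, ∀ n, wordFactor ω 0 n ∈ T := by
  classical
  have := Fintype.ofFinite α
  -- A big word is one with extensions of every length in `T`. As the alphabet is finite, some
  -- one-letter extension is big again.
  let big : List α → Prop := fun w => ∀ n, ∃ u : List α, u.length = n ∧ w ++ u ∈ T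
  have hstep : ∀ w : {w // big w}, ∃ a, big (w.1 ++ [a]) := by
    rintro ⟨w, hw⟩
    by_contra hcon
    simp only [big, not_exists, not_forall] at hcon
    choose f hf using hcon
    obtain ⟨u, hu, huT⟩ := hw (Finset.univ.sup f + 1)
    obtain ⟨a, u, rfl⟩ := List.exists_cons_of_length_eq_add_one hu
    have hle : f a ≤ u.length := by
      have := Finset.le_sup (f := f) (Finset.mem_univ a)
      simp at hu
      omega
    refine hf a (u.take (f a)) ⟨by simp [hle], hpre _ (u.drop (f a)) ?_⟩
    simpa using huT
  choose nxt hnxt using hstep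
  have h0 : big [] := fun n => by
    obtain ⟨w, hw, hn⟩ := hT n
    exact ⟨w, hn, by simpa using hw⟩
  let s : ℕ → {w // big w} := fun n =>
    Nat.rec ⟨[], h0⟩ (fun _ w => ⟨w.1 ++ [nxt w], hnxt w⟩) n
  refine ⟨fun n => nxt (s n), fun n => ?_⟩
  have hs : ∀ n, wordFactor (fun n => nxt (s n)) 0 n = (s n).1 := by
    intro n
    induction n with
    | zero => rfl
    | succ n ih =>
      rw [wordFactor_add, ih]
      simp [wordFactor, s]
  rw [hs]
  obtain ⟨u, -, hu⟩ := (s n).2 0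
  exact hpre _ _ hu

theorem finite_range_wordFactor [Finite α] (m : ℕ) :
    (Set.range fun i => wordFactor ω i m).Finite :=
  (List.finite_length_eq α m).subset (by rintro _ ⟨i, rfl⟩; simp)

theorem image_take_range_wordFactor (n : ℕ) :
    List.take n '' (Set.range fun i => wordFactor ω i (n + 1)) =
      Set.range fun i => wordFactor ω i n := by
  rw [← Set.range_comp]
  congr 1
  ext1 i
  simp [wordFactor_add]

/-- The Morse–Hedlund theorem: an infinite word with at most `m` factors of some length `m` is
eventually periodic. -/
theorem exists_period_of_ncard_le [Finite α] {m : ℕ}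
    (hm : (Set.range fun i => wordFactor ω i m).ncard ≤ m) :
    ∃ i t, 0 < t ∧ t ≤ m ∧ ∀ s, ω (i + s) = ω (i + t + s) := by
  set p : ℕ → ℕ := fun n => (Set.range fun i => wordFactor ω i n).ncard with hp
  have hmono : Monotone p := monotone_nat_of_le_succ fun n => by
    simp only [hp]
    rw [← image_take_range_wordFactor]
    exact Set.ncard_image_le (finite_range_wordFactor ω (n + 1))
  -- The number of factors starts at 1 and is at most `m` at length `m`, so it cannot increase at
  -- each of the `m` steps.
  obtain ⟨n, hnm, hn⟩ : ∃ n < m, p (n + 1) ≤ p n := by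
    by_contra hcon
    push Not at hcon
    have : ∀ n ≤ m, n + 1 ≤ p n := by
      intro n
      induction n with
      | zero =>
        intro _
        exact (Set.ncard_pos (finite_range_wordFactor ω 0)).2 ⟨_, 0, rfl⟩
      | succ n ih => intro h; have := hcon n h; have := ih (by omega); omega
    have h1 : m + 1 ≤ p m := this m le_rfl
    exact absurd h1 (not_le.2 (Nat.lt_succ_of_le hm))
  -- Equal counts at `n` and `n + 1` mean that a factor of length `n` determines the letter
  -- following it.
  have hinj : Set.InjOn (List.take n) (Set.range fun i => wordFactor ω i (n + 1)) := by
    refine Set.injOn_of_ncard_image_eq ?_ (finite_range_wordFactor ω (n + 1))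
    rw [image_take_range_wordFactor]
    exact le_antisymm (hmono n.le_succ) hn
  have hext : ∀ {i j}, wordFactor ω i n = wordFactor ω j n →
      wordFactor ω i (n + 1) = wordFactor ω j (n + 1) := fun {i j} h =>
    hinj ⟨i, rfl⟩ ⟨j, rfl⟩ (by simp [wordFactor_add, h])
  have hper : ∀ {i j}, wordFactor ω i n = wordFactor ω j n →
      ∀ s, wordFactor ω (i + s) n = wordFactor ω (j + s) n := by
    intro i j h s
    induction s with
    | zero => exact h
    | succ s ih =>
      refine wordFactor_eq_of ω fun t ht => ?_
      have := wordFactor_congr ω (hext ih) (Nat.succ_lt_succ ht)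
      simpa only [add_assoc, add_comm 1 t] using this
  obtain ⟨i, hi, j, hj, hij, he⟩ : ∃ i ∈ Finset.range (p n + 1), ∃ j ∈ Finset.range (p n + 1),
      i ≠ j ∧ wordFactor ω i n = wordFactor ω j n := by
    refine Finset.exists_ne_map_eq_of_card_lt_of_maps_to
      (t := (finite_range_wordFactor ω n).toFinset) ?_ (fun i _ => by simp)
    rw [← Set.ncard_eq_toFinset_card _ (finite_range_wordFactor ω n)]
    simp [hp]
  wlog hlt : i < j generalizing i j
  · exact this j hj i hi hij.symm he.symm (by omega)
  have hjm : j ≤ m := by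
    have h1 := hmono hnm.le
    have h2 := Finset.mem_range.1 hj
    have h3 : p m ≤ m := hm
    omega
  -- Starting at `i + n` uses the letter that follows the factor, so the case `n = 0` needs no
  -- separate treatment.
  refine ⟨i + n, j - i, by omega, by omega, fun s => ?_⟩
  have h := wordFactor_congr ω (hext (hper he s)) (Nat.lt_succ_self n)
  have e1 : i + n + s = i + s + n := by omega
  have e2 : i + n + (j - i) + s = j + s + n := by omega
  rw [e1, e2, h]

theorem wordFactor_periodic {i t : ℕ} (h : ∀ s, ω (i + s) = ω (i + t + s)) (k : ℕ) :
    wordFactor ω i (k * t) = (List.replicate k (wordFactor ω i t)).flatten := by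
  have h2 : ∀ k s, ω (i + s) = ω (i + k * t + s) := by
    intro k
    induction k with
    | zero => intro s; simp
    | succ k ih =>
      intro s
      have e : i + (k + 1) * t + s = i + t + (k * t + s) := by ring
      rw [ih, add_assoc, h, e]
  induction k with
  | zero => simp [wordFactor]
  | succ k ih =>
    rw [add_mul, one_mul, wordFactor_add, ih, List.replicate_succ', List.flatten_append,
      wordFactor_eq_of ω (i := i + k * t) (j := i) (fun s _ => (h2 k s).symm)]
    simp

end

/-! ### Normal words in the shortlex order -/

section

variable {L B : Type*} [Field L] [Ring B] [Algebra L B] {r : ℕ}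

theorem shortlex_append_right {a b : List (Fin r)} (h : List.Shortlex (· < ·) a b)
    (c : List (Fin r)) : List.Shortlex (· < ·) (a ++ c) (b ++ c) := by
  rcases List.shortlex_def.1 h with h | ⟨hl, h⟩
  · exact List.Shortlex.of_length_lt (by simpa using h)
  · refine List.Shortlex.of_lex (by simpa using hl) ?_
    induction h with
    | nil => simp at hl
    | cons _ ih => exact List.Lex.cons (ih (List.shortlex_def.2 (Or.inr ⟨by simpa using hl, ‹_›⟩))
        (by simpa using hl))
    | rel h' => exact List.Lex.rel h'

variable (L) in
/-- The element `q w` is not a linear combination of the `q w'` with `w' < w` in the shortlex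
order. -/
def IsNormalWord (g : Fin r → B) (q : B) (w : List (Fin r)) : Prop :=
  q * (w.map g).prod ∉
    Submodule.span L ((fun w' => q * (w'.map g).prod) '' {w' | List.Shortlex (· < ·) w' w})

variable {g : Fin r → B} {q : B}

theorem IsNormalWord.left {a b : List (Fin r)} (h : IsNormalWord L g q (a ++ b)) :
    IsNormalWord L g q a := by
  intro ha
  apply h
  have := Submodule.mem_map_of_mem (f := LinearMap.mulRight L (b.map g).prod) ha
  rw [Submodule.map_span] at this
  have h2 := Submodule.span_mono (t := (fun w' => q * (w'.map g).prod) ''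
    {w' | List.Shortlex (· < ·) w' (a ++ b)}) (R := L) (by
      rintro _ ⟨_, ⟨w, hw, rfl⟩, rfl⟩
      exact ⟨w ++ b, shortlex_append_right hw b, by simp [mul_assoc]⟩) this
  simpa [mul_assoc] using h2

/-- A relation for `b` multiplied on the left by `q` and the product of `a` is a relation for `a ++
b`. The factor `q` is absorbed, so suffixes are normal relative to `1`. -/
theorem IsNormalWord.right {a b : List (Fin r)} (h : IsNormalWord L g q (a ++ b)) :
    IsNormalWord L g 1 b := by
  intro hb
  apply h
  have := Submodule.mem_map_of_mem (f := LinearMap.mulLeft L (q * (a.map g).prod)) hb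
  rw [Submodule.map_span] at this
  have h2 := Submodule.span_mono (t := (fun w' => q * (w'.map g).prod) ''
    {w' | List.Shortlex (· < ·) w' (a ++ b)}) (R := L) (by
      rintro _ ⟨_, ⟨w, hw, rfl⟩, rfl⟩
      exact ⟨a ++ w, List.Shortlex.append_left hw a, by simp⟩) this
  simpa [mul_assoc] using h2

/-- In a nontrivial relation the shortlex-largest word with nonzero coefficient would be a
combination of smaller ones. -/
theorem linearIndependent_of_isNormalWord {ι : Type*} (f : ι → List (Fin r))
    (hf : Function.Injective f) (hn : ∀ i, IsNormalWord L g q (f i)) :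
    LinearIndependent L fun i => q * ((f i).map g).prod := by
  classical
  rw [linearIndependent_iff']
  intro s c hs
  by_contra hcon
  push Not at hcon
  obtain ⟨i, hi, hi0⟩ := hcon
  obtain ⟨j, hj', hmax⟩ := Finset.exists_max_image (s.filter fun i => c i ≠ 0)
    (fun i => toLex ((f i).length, f i)) ⟨i, by simp [hi, hi0]⟩
  obtain ⟨hj, hj0⟩ := Finset.mem_filter.1 hj'
  apply hn j
  rw [← Finset.add_sum_erase _ _ hj] at hs
  have h1 : q * ((f j).map g).prod =
      -(c j)⁻¹ • ∑ i ∈ s.erase j, c i • (q * ((f i).map g).prod) := by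
    rw [eq_neg_of_add_eq_zero_right hs, smul_neg, neg_smul, neg_neg, smul_smul,
      inv_mul_cancel₀ hj0, one_smul]
  rw [h1]
  refine Submodule.smul_mem _ _ (Submodule.sum_mem _ fun i hi => ?_)
  obtain ⟨hij, his⟩ := Finset.mem_erase.1 hi
  by_cases hci : c i = 0
  · rw [hci, zero_smul]; exact zero_mem _
  · refine Submodule.smul_mem _ _ (Submodule.subset_span ⟨f i, ?_, rfl⟩)
    have h2 := hmax i (Finset.mem_filter.2 ⟨his, hci⟩)
    rcases Prod.Lex.le_iff.1 h2 with h | ⟨h, h'⟩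
    · exact List.Shortlex.of_length_lt h
    · exact List.Shortlex.of_lex h
        ((List.lt_iff_lex_lt _ _).1 (lt_of_le_of_ne h' fun h => hij (hf h)))

variable {W : Submodule L B}

theorem prod_map_mem_pow (hg : ∀ i, g i ∈ W) (w : List (Fin r)) :
    (w.map g).prod ∈ W ^ w.length := by
  induction w with
  | nil =>
    rw [List.map_nil, List.prod_nil, List.length_nil, pow_zero]
    exact Submodule.one_le.1 le_rfl
  | cons a w ih =>
    rw [List.map_cons, List.prod_cons, List.length_cons, pow_succ']
    exact Submodule.mul_mem_mul (hg a) ih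

theorem pow_eq_span_words (hg : Submodule.span L (Set.range g) = W) (n : ℕ) :
    W ^ n = Submodule.span L ((fun w : List (Fin r) => (w.map g).prod) '' {w | w.length = n}) := by
  refine le_antisymm ?_ (Submodule.span_le.2 ?_)
  · induction n with
    | zero =>
      rw [pow_zero, Submodule.one_le]
      exact Submodule.subset_span ⟨[], rfl, rfl⟩
    | succ n ih =>
      rw [pow_succ']
      refine (mul_le_mul' hg.ge ih).trans ?_
      rw [Submodule.span_mul_span]
      refine Submodule.span_mono ?_
      rintro _ ⟨_, ⟨i, rfl⟩, _, ⟨w, hw, rfl⟩, rfl⟩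
      exact ⟨i :: w, by simpa using hw, by simp⟩
  · rintro _ ⟨w, rfl, rfl⟩
    exact prod_map_mem_pow (fun i => hg ▸ Submodule.subset_span ⟨i, rfl⟩) w

/-- If no word of length `n` were normal, well-founded induction would rewrite every `q w` of length
`n` by shorter words, giving `qWⁿ ⊆ qWⁿ⁻¹` against strict growth. -/
theorem exists_isNormalWord [IsPrimeRing B] (hW : IsFrame W) (hB : ¬ FiniteDimensional L B)
    (hg : Submodule.span L (Set.range g) = W) (hq : q ≠ 0) (n : ℕ) :
    ∃ w, IsNormalWord L g q w ∧ w.length = n := by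
  classical
  by_contra hcon
  push Not at hcon
  rcases Nat.eq_zero_or_pos n with rfl | hn
  · refine hcon [] (fun h => hq ?_) rfl
    have he : {w' : List (Fin r) | List.Shortlex (· < ·) w' []} = ∅ := by ext; simp
    rw [he, Set.image_empty, Submodule.span_empty, Submodule.mem_bot] at h
    simpa using h
  have hmem : ∀ w : List (Fin r), w.length ≤ n →
      q * (w.map g).prod ∈ (W ^ (n - 1)).map (LinearMap.mulLeft L q) := by
    intro w
    have hwf : WellFounded (List.Shortlex (α := Fin r) (· < ·)) := List.Shortlex.wf wellFounded_lt
    induction w using hwf.induction with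
    | _ w ih =>
      intro hw
      rcases hw.lt_or_eq with h | h
      · exact ⟨_, hW.pow_mono (by omega) (prod_map_mem_pow
          (fun i => hg ▸ Submodule.subset_span ⟨i, rfl⟩) w), rfl⟩
      · have h1 : q * (w.map g).prod ∈ _ := not_not.1 fun h2 => hcon w h2 h
        refine Submodule.span_le.2 ?_ h1
        rintro _ ⟨w', hw', rfl⟩
        refine ih w' hw' ?_
        rcases List.shortlex_def.1 hw' with h3 | h3 <;> omega
  have hle : (W ^ n).map (LinearMap.mulLeft L q) ≤
      (W ^ (n - 1)).map (LinearMap.mulLeft L q) := by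
    rw [pow_eq_span_words hg n, Submodule.map_span, Submodule.span_le]
    rintro _ ⟨_, ⟨w, hw, rfl⟩, rfl⟩
    exact hmem w (le_of_eq hw)
  obtain ⟨k, rfl⟩ : ∃ k, n = k + 1 := ⟨n - 1, by omega⟩
  exact not_lt_of_ge hle (hW.map_mulLeft_lt_succ hB hq k)

end

end Words

/-! ### Generic fibres, and the dichotomy between identities and quadratic growth -/

open scoped Polynomial TensorProduct

section

variable {L B : Type*} [Field L] [Ring B] [Algebra L B]

/-- `B` as an `L[X]`-module on which `X` acts as right multiplication by `v`. -/
abbrev RightPolyModule (L : Type*) {B : Type*} [Field L] [Ring B] [Algebra L B] (v : B) : Type _ :=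
  AEval' (LinearMap.mulRight L v)

theorem aeval_mulRight_apply (v x : B) (p : L[X]) :
    Polynomial.aeval (LinearMap.mulRight L v) p x = x * Polynomial.aeval v p := by
  rw [Polynomial.aeval_eq_sum_range, Polynomial.aeval_eq_sum_range, LinearMap.sum_apply,
    Finset.mul_sum]
  refine Finset.sum_congr rfl fun i _ => ?_
  rw [LinearMap.smul_apply, LinearMap.pow_mulRight, LinearMap.mulRight_apply, mul_smul_comm]

theorem smul_of_rightPolyModule (v x : B) (p : L[X]) :
    p • (AEval'.of (LinearMap.mulRight L v) x) =
      AEval'.of (LinearMap.mulRight L v) (x * Polynomial.aeval v p) := by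
  rw [← aeval_mulRight_apply]
  rfl

/-- Left multiplication as an endomorphism of the `L[X]`-module `B`. -/
noncomputable def leftMulRightPoly (v : B) : B →+* End L[X] (RightPolyModule L v) where
  toFun b := LinearMap.ofAEval _
    ((AEval'.of (LinearMap.mulRight L v)).toLinearMap ∘ₗ LinearMap.mulLeft L b) (fun m => by
      change AEval'.of _ (b * (m * v)) = _
      rw [← mul_assoc]
      exact (AEval'.X_smul_of (φ := LinearMap.mulRight L v) (b * m)).symm)
  map_one' := by
    ext x
    exact congrArg (AEval'.of (LinearMap.mulRight L v)) (one_mul _)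
  map_zero' := by
    ext x
    exact congrArg (AEval'.of (LinearMap.mulRight L v)) (zero_mul _)
  map_mul' a b := by
    ext x
    exact congrArg (AEval'.of (LinearMap.mulRight L v)) (mul_assoc _ _ _)
  map_add' a b := by
    ext x
    exact congrArg (AEval'.of (LinearMap.mulRight L v)) (add_mul _ _ _)

/-- The generic fibre of the `L[X]`-module `B`, a vector space over the field of fractions. -/
abbrev GenericFibre (L : Type*) {B : Type*} [Field L] [Ring B] [Algebra L B] (v : B) : Type _ :=
  FractionRing L[X] ⊗[L[X]] RightPolyModule L v

/-- The action of `B` on the generic fibre by left multiplication. -/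
noncomputable def genericAction (v : B) :
    B →+* End (FractionRing L[X]) (GenericFibre L v) :=
  ((End.baseChangeHom L[X] (FractionRing L[X]) (RightPolyModule L v)).toRingHom).comp
    (leftMulRightPoly v)

/-- The image of an element of `B` in the generic fibre. -/
noncomputable def toGenericFibre (v : B) : B →ₗ[L] GenericFibre L v :=
  ((TensorProduct.mk L[X] (FractionRing L[X]) (RightPolyModule L v) 1).restrictScalars L) ∘ₗ
    (AEval'.of (LinearMap.mulRight L v)).toLinearMap

theorem genericAction_apply (v b x : B) :
    genericAction (L := L) v b (toGenericFibre v x) = toGenericFibre v (b * x) := rfl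

/-- The kernel of localization is torsion, and `x p(v) = 0` with `p ≠ 0` is a linear relation among
the `x vᵏ`. -/
theorem toGenericFibre_ne_zero {v x : B} (h : LinearIndependent L fun k : ℕ => x * v ^ k) :
    toGenericFibre (L := L) v x ≠ 0 := by
  intro h0
  obtain ⟨⟨p, hp⟩, hpx⟩ := (IsLocalizedModule.eq_zero_iff (nonZeroDivisors L[X])
    (TensorProduct.mk L[X] (FractionRing L[X]) (RightPolyModule L v) 1)).1 h0
  have h1 : p • (AEval'.of (LinearMap.mulRight L v) x) = 0 := hpx
  rw [smul_of_rightPolyModule, LinearEquiv.map_eq_zero_iff, Polynomial.aeval_eq_sum_range,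
    Finset.mul_sum] at h1
  refine nonZeroDivisors.ne_zero hp (Polynomial.ext fun i => ?_)
  by_cases hi : i ∈ Finset.range (p.natDegree + 1)
  · simp only [mul_smul_comm] at h1
    exact linearIndependent_iff'.1 h _ _ h1 i hi
  · rw [Polynomial.coeff_zero]
    exact Polynomial.coeff_eq_zero_of_natDegree_lt (by simpa using hi)

variable {W : Submodule L B}

theorem span_range_toGenericFibre (v : B) :
    Submodule.span (FractionRing L[X]) (Set.range (toGenericFibre (L := L) v)) = ⊤ := by
  refine eq_top_iff.2 fun x _ => ?_
  induction x using TensorProduct.induction_on with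
  | zero => exact zero_mem _
  | add x y hx hy => exact add_mem (hx trivial) (hy trivial)
  | tmul f m =>
    have : f ⊗ₜ[L[X]] m = f • toGenericFibre (L := L) v
        ((AEval'.of (LinearMap.mulRight L v)).symm m) := by
      change _ = f • ((1 : FractionRing L[X]) ⊗ₜ[L[X]] m)
      rw [TensorProduct.smul_tmul', smul_eq_mul, mul_one]
    rw [this]
    exact Submodule.smul_mem _ _ (Submodule.subset_span ⟨_, rfl⟩)

/-- If the generic fibre is infinite dimensional, then it grows at least linearly. -/
theorem lt_finrank_span_toGenericFibre (hW : IsFrame W) {v : B}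
    (hE : ¬ FiniteDimensional (FractionRing L[X]) (GenericFibre L v)) (n : ℕ) :
    FiniteDimensional (FractionRing L[X])
        (Submodule.span (FractionRing L[X]) (toGenericFibre (L := L) v '' (W ^ n : Submodule L B))) ∧
      n < finrank (FractionRing L[X])
        (Submodule.span (FractionRing L[X]) (toGenericFibre (L := L) v '' (W ^ n : Submodule L B))) := by
  set U : ℕ → Submodule (FractionRing L[X]) (GenericFibre L v) := fun n =>
    Submodule.span (FractionRing L[X]) (toGenericFibre (L := L) v '' (W ^ n : Submodule L B)) with hU
  have htop : ∀ P : Submodule (FractionRing L[X]) (GenericFibre L v),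
      FiniteDimensional (FractionRing L[X]) P → ¬ ∀ b, toGenericFibre v b ∈ P := by
    intro P hP hall
    have : P = ⊤ := by
      rw [eq_top_iff, ← span_range_toGenericFibre, Submodule.span_le]
      rintro _ ⟨b, rfl⟩
      exact hall b
    subst this
    exact hE (Module.finite_def.2 (Module.Finite.iff_fg.1 hP))
  have hfin : ∀ n, FiniteDimensional (FractionRing L[X]) (U n) := by
    intro n
    obtain ⟨s, hs⟩ := Module.Finite.iff_fg.1 (hW.finite_pow n)
    have : U n = Submodule.span (FractionRing L[X]) (toGenericFibre (L := L) v '' s) := by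
      simp only [hU]
      rw [← hs, ← Submodule.map_coe, Submodule.map_span, Submodule.span_span_of_tower]
    rw [this]
    exact FiniteDimensional.span_of_finite _ (s.finite_toSet.image _)
  refine ⟨hfin n, lt_finrank_of_strict_chain U hfin (fun h0 => ?_) (fun j => ?_) n⟩
  · refine htop ⊥ inferInstance fun b => ?_
    have h1 : toGenericFibre (L := L) v 1 ∈ U 0 :=
      Submodule.subset_span ⟨1, hW.one_mem_pow 0, rfl⟩
    rw [h0, Submodule.mem_bot] at h1
    rw [← mul_one b, ← genericAction_apply, h1, map_zero]
    exact zero_mem _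
  · refine lt_of_le_of_ne (Submodule.span_mono (Set.image_mono (hW.pow_mono j.le_succ)))
      fun h => htop (U j) (hfin j) ?_
    -- If `U j = U (j + 1)`, then `U j` is stable under `W`, so it contains the image of `B`, which
    -- spans the fibre.
    have hstab : ∀ w ∈ W, ∀ x ∈ U j, genericAction (L := L) v w x ∈ U j := by
      intro w hw x hx
      rw [h]
      have : U j ≤ (U (j + 1)).comap (genericAction (L := L) v w) := by
        refine Submodule.span_le.2 ?_
        rintro _ ⟨b, hb, rfl⟩
        rw [SetLike.mem_coe, Submodule.mem_comap, genericAction_apply]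
        refine Submodule.subset_span ⟨_, ?_, rfl⟩
        rw [pow_succ']
        exact Submodule.mul_mem_mul hw hb
      exact this hx
    intro b
    obtain ⟨k, hk⟩ := hW.exists_mem_pow b
    have hind : ∀ k, ∀ b ∈ W ^ (j + k), toGenericFibre (L := L) v b ∈ U j := by
      intro k
      induction k with
      | zero => exact fun b hb => Submodule.subset_span ⟨b, hb, rfl⟩
      | succ k ih =>
        intro b hb
        rw [← add_assoc, pow_succ'] at hb
        refine Submodule.mul_induction_on hb (fun w hw c hc => ?_) (fun c d hc hd => ?_)
        · rw [← genericAction_apply]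
          exact hstab w hw _ (ih c hc)
        · rw [map_add]; exact add_mem hc hd
    exact hind k b (hW.pow_mono (Nat.le_add_left k j) hk)

/-- If the generic fibre is infinite dimensional, then `B` grows at least quadratically. -/
theorem sq_le_finrank_of_not_finite (hW : IsFrame W) {v : B} {l : ℕ} (hv : v ∈ W ^ l)
    (hE : ¬ FiniteDimensional (FractionRing L[X]) (GenericFibre L v)) (n : ℕ) :
    n ^ 2 ≤ finrank L ↥(W ^ ((1 + l) * n)) := by
  obtain ⟨hfin, hlt⟩ := lt_finrank_span_toGenericFibre hW hE n
  obtain ⟨c, hc, hspan, hli⟩ := exists_linearIndependent (FractionRing L[X])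
    (toGenericFibre (L := L) v '' (W ^ n : Submodule L B))
  choose β hβ hβc using fun x : c => hc x.2
  have h1 : LinearIndependent L[X] fun x : c => AEval'.of (LinearMap.mulRight L v) (β x) := by
    refine LinearIndependent.of_comp
      (TensorProduct.mk L[X] (FractionRing L[X]) (RightPolyModule L v) 1) ?_
    have h2 : LinearIndependent L[X] ((↑) : c → GenericFibre L v) :=
      hli.restrict_scalars' L[X]
    convert h2 using 1
    ext x
    exact hβc x
  have h2 : LinearIndependent L fun i : Fin n => (Polynomial.X : L[X]) ^ (i : ℕ) := by
    have h := (Polynomial.basisMonomials L).linearIndependent.comp _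
      (Fin.val_injective (n := n))
    convert h using 1
    ext1 i
    simp [Polynomial.X_pow_eq_monomial]
  have h3 := linearIndependent_smul h2 h1
  have h4 : LinearIndependent L fun p : Fin n × c => β p.2 * v ^ (p.1 : ℕ) := by
    refine LinearIndependent.of_comp (AEval'.of (LinearMap.mulRight L v)).toLinearMap ?_
    convert h3 using 1
    ext1 p
    rw [smul_of_rightPolyModule]
    simp
  have hfW := hW.finite_pow ((1 + l) * n)
  let f : Fin n × c → ↥(W ^ ((1 + l) * n)) := fun p => ⟨β p.2 * v ^ (p.1 : ℕ), by
    have h5 : v ^ (p.1 : ℕ) ∈ W ^ (l * p.1) := by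
      rw [pow_mul]; exact Submodule.pow_mem_pow _ hv _
    refine hW.pow_mono ?_ (IsFrame.mul_mem_pow (hβ p.2) h5)
    have := Nat.mul_le_mul_left l p.1.2.le
    linarith⟩
  have h5 : LinearIndependent L f := LinearIndependent.of_comp (W ^ ((1 + l) * n)).subtype h4
  rw [← hspan] at hfin hlt
  rcases Nat.eq_zero_or_pos n with rfl | hn
  · simp
  have := h5.finite
  have : Finite c := Finite.of_injective (fun x : c => ((⟨0, hn⟩ : Fin n), x))
    fun x y h => (Prod.ext_iff.1 h).2
  have := Fintype.ofFinite c
  have h6 := finrank_span_eq_card hli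
  rw [Subtype.range_coe] at h6
  have h7 := h5.fintype_card_le_finrank
  simp only [Fintype.card_prod, Fintype.card_fin] at h7
  rw [h6] at hlt
  calc n ^ 2 = n * n := sq n
    _ ≤ n * Fintype.card c := Nat.mul_le_mul_left _ hlt.le
    _ ≤ _ := h7

theorem sum_ncard_wordFactor_le_finrank (hW : IsFrame W) {r : ℕ} {g : Fin r → B}
    (hg : ∀ i, g i ∈ W) {ω : ℕ → Fin r} (hω : ∀ i m, IsNormalWord L g 1 (wordFactor ω i m)) (n : ℕ) :
    ∑ m ∈ Finset.range (n + 1), (Set.range fun i => wordFactor ω i m).ncard ≤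
      finrank L ↥(W ^ n) := by
  classical
  let P : ℕ → Finset (List (Fin r)) := fun m => (finite_range_wordFactor ω m).toFinset
  have hP : ∀ {m w}, w ∈ P m → ∃ i, wordFactor ω i m = w := fun {m w} hw => by
    simpa [P] using hw
  let s := (Finset.range (n + 1)).biUnion P
  have hs : s.card = ∑ m ∈ Finset.range (n + 1), (Set.range fun i => wordFactor ω i m).ncard := by
    rw [Finset.card_biUnion]
    · exact Finset.sum_congr rfl fun m _ => (Set.ncard_eq_toFinset_card _ _).symm
    · intro a _ b _ hab
      refine Finset.disjoint_left.2 fun w ha hb => hab ?_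
      obtain ⟨i, rfl⟩ := hP ha
      obtain ⟨j, hj⟩ := hP hb
      simpa using (congrArg List.length hj).symm
  have hmem : ∀ w : s, ∃ i m, m ≤ n ∧ wordFactor ω i m = w.1 := by
    rintro ⟨w, hw⟩
    obtain ⟨m, hm, hwm⟩ := Finset.mem_biUnion.1 hw
    obtain ⟨i, hi⟩ := hP hwm
    exact ⟨i, m, Nat.lt_succ_iff.1 (Finset.mem_range.1 hm), hi⟩
  have hli : LinearIndependent L fun w : s => 1 * (w.1.map g).prod :=
    linearIndependent_of_isNormalWord _ Subtype.val_injective fun w => by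
      obtain ⟨i, m, -, h⟩ := hmem w
      exact h ▸ hω i m
  let f : s → ↥(W ^ n) := fun w => ⟨1 * (w.1.map g).prod, by
    obtain ⟨i, m, hm, h⟩ := hmem w
    have := prod_map_mem_pow hg w.1
    rw [← h, length_wordFactor, h] at this
    rw [one_mul]
    exact hW.pow_mono hm this⟩
  have := hW.finite_pow n
  have h := (LinearIndependent.of_comp (v := f) (W ^ n).subtype hli).fintype_card_le_finrank
  rwa [Fintype.card_coe, hs] at h

/-- If `B` does not grow quadratically, then for each `q ≠ 0` some `q w` is not torsion with respect
to right multiplication by a word `u`, of length bounded independently of `q`. -/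
theorem exists_linearIndependent_mul_pow [IsPrimeRing B] (hW : IsFrame W)
    (hB : ¬ FiniteDimensional L B) {r : ℕ} {g : Fin r → B}
    (hg : Submodule.span L (Set.range g) = W) {n : ℕ} (hn : finrank L ↥(W ^ (2 * n)) < n ^ 2)
    {q : B} (hq : q ≠ 0) : ∃ w, ∃ u : List (Fin r), u.length ≤ 2 * n ∧
      LinearIndependent L fun k : ℕ => q * w * (u.map g).prod ^ k := by
  obtain ⟨ω, hω⟩ := exists_infinite_word {w | IsNormalWord L g q w} (fun a b h => h.left)
    (exists_isNormalWord hW hB hg hq)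
  have hω1 : ∀ i m, IsNormalWord L g 1 (wordFactor ω i m) := fun i m => by
    have : IsNormalWord L g q (wordFactor ω 0 (i + m)) := hω (i + m)
    rw [wordFactor_add, zero_add] at this
    exact this.right
  -- Otherwise the independent factors of length at most `2n` would number at least `0 + 1 + ⋯ + 2n
  -- = 2n² + n`, exceeding `dim W^(2n)`.
  obtain ⟨m, hm2, hm⟩ : ∃ m ≤ 2 * n, (Set.range fun i => wordFactor ω i m).ncard ≤ m := by
    by_contra hcon
    push Not at hcon
    have h1 := sum_ncard_wordFactor_le_finrank hW
      (fun i => hg ▸ Submodule.subset_span ⟨i, rfl⟩) hω1 (2 * n)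
    have h2 : ∑ m ∈ Finset.range (2 * n + 1), m ≤
        ∑ m ∈ Finset.range (2 * n + 1), (Set.range fun i => wordFactor ω i m).ncard :=
      Finset.sum_le_sum fun m hm => (hcon m (Nat.lt_succ_iff.1 (Finset.mem_range.1 hm))).le
    have h3 := Finset.sum_range_id_mul_two (2 * n + 1)
    have h4 : (2 * n + 1) * (2 * n + 1 - 1) = (2 * n ^ 2 + n) * 2 := by
      rw [Nat.add_sub_cancel]; ring
    omega
  obtain ⟨i, t, ht, htm, hper⟩ := exists_period_of_ncard_le ω hm
  refine ⟨((wordFactor ω 0 i).map g).prod, wordFactor ω i t, by simp; omega, ?_⟩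
  -- The prefixes of length `i + kt` are normal relative to `q` and spell `w uᵏ`.
  have h := linearIndependent_of_isNormalWord (L := L) (g := g) (q := q)
    (fun k : ℕ => wordFactor ω 0 (i + k * t)) (fun k k' hk => by
      have := congrArg List.length hk
      simp only [length_wordFactor, add_right_inj] at this
      exact Nat.eq_of_mul_eq_mul_right ht this) fun k => hω _
  convert h using 1
  ext1 k
  rw [wordFactor_add, zero_add, wordFactor_periodic ω hper, List.map_append, List.prod_append,
    mul_assoc]
  congr 2
  induction k with
  | zero => simp
  | succ k ih => rw [pow_succ', ih, List.replicate_succ, List.flatten_cons, List.map_append,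
      List.prod_append]

/-- A prime algebra either satisfies a standard identity or grows at least quadratically. -/
theorem exists_satisfiesStandard_or_sq_le_finrank [IsPrimeRing B] (hW : IsFrame W)
    (hB : ¬ FiniteDimensional L B) :
    (∃ N, SatisfiesStandard N B) ∨ ∃ a, ∀ n, n ^ 2 ≤ finrank L ↥(W ^ (a * n)) := by
  obtain ⟨r, g, hg⟩ := Submodule.fg_iff_exists_fin_generating_family.1
    (Module.Finite.iff_fg.1 hW.finite)
  by_cases hquad : ∀ n, n ^ 2 ≤ finrank L ↥(W ^ (2 * n))
  · exact Or.inr ⟨2, hquad⟩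
  push Not at hquad
  obtain ⟨n, hn⟩ := hquad
  -- All candidates for the period `u`; the bound `2n` is independent of `q`, so finitely many
  -- fibres suffice for a faithful action.
  let S := {u : List (Fin r) // u.length ≤ 2 * n}
  have hS : Finite S := (List.finite_length_le (Fin r) (2 * n)).to_subtype
  have := Fintype.ofFinite S
  by_cases hE : ∀ u : S, FiniteDimensional (FractionRing L[X]) (GenericFibre L (u.1.map g).prod)
  · left
    let φ : B →+* ∀ u : S, End (FractionRing L[X]) (GenericFibre L (u.1.map g).prod) :=
      RingHom.pi fun u => genericAction _
    have hφ : Function.Injective φ := (injective_iff_map_eq_zero φ).2 fun q hq => ?_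
    · have h := satisfiesStandard_of_finite (FractionRing L[X])
        (∀ u : S, End (FractionRing L[X]) (GenericFibre L (u.1.map g).prod))
      exact ⟨_, h.of_injective φ hφ⟩
    by_contra hq0
    obtain ⟨w, u, hu, hli⟩ := exists_linearIndependent_mul_pow hW hB hg hn hq0
    refine toGenericFibre_ne_zero hli ?_
    rw [← genericAction_apply]
    exact LinearMap.congr_fun (congrFun hq ⟨u, hu⟩) _
  · right
    push Not at hE
    obtain ⟨u, hu⟩ := hE
    exact ⟨_, sq_le_finrank_of_not_finite hW
      (prod_map_mem_pow (fun i => hg ▸ Submodule.subset_span ⟨i, rfl⟩) u.1) hu⟩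

end

/-! ### The Martindale ring of quotients and its centre -/

namespace MartindaleQuotient

open IdealHom

variable {A : Type*} [Ring A] [IsPrimeRing A]

theorem mk_mul_of (f : IdealHom A) {x : A} (hx : x ∈ f.dom) :
    mk f * of x = of (f.hom ⟨x, hx⟩) :=
  mk_eq_of fun y _ _ => hom_mul f x hx y _

theorem of_injective : Function.Injective (of : A →+* MartindaleQuotient A) := by
  intro a b h
  obtain ⟨J, hJ, hab⟩ : Rel (lmul a) (lmul b) := Quotient.exact (s := IdealHom.setoid A) h
  obtain ⟨x, hx, hx0⟩ := ne_bot_iff.1 hJ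
  refine sub_eq_zero.1 ((IsPrimeRing.eq_zero_or_eq_zero (a - b) x fun r => ?_).resolve_right hx0)
  obtain ⟨_, _, h⟩ := hab (r * x) (J.mul_mem_left _ _ hx)
  have h' : a * (r * x) = b * (r * x) := h
  rw [mul_assoc, sub_mul, h', sub_self]

theorem exists_ideal_mul_of_eq (q : MartindaleQuotient A) :
    ∃ J : TwoSidedIdeal A, J ≠ ⊥ ∧ ∀ x ∈ J, ∃ a, q * of x = of a := by
  obtain ⟨f⟩ := q
  exact ⟨f.dom, f.dom_ne_bot, fun x hx => ⟨_, mk_mul_of f hx⟩⟩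

theorem ext_of_ideal {p q : MartindaleQuotient A} {J : TwoSidedIdeal A} (hJ : J ≠ ⊥)
    (h : ∀ x ∈ J, p * of x = q * of x) : p = q := by
  obtain ⟨f⟩ := p
  obtain ⟨g⟩ := q
  refine Quotient.sound (s := IdealHom.setoid A)
    ⟨J ⊓ (f.dom ⊓ g.dom), inf_ne_bot hJ (inf_ne_bot f.dom_ne_bot g.dom_ne_bot), fun x hx => ?_⟩
  simp only [TwoSidedIdeal.mem_inf] at hx
  obtain ⟨hx, hf, hg⟩ := hx
  refine ⟨hf, hg, of_injective ?_⟩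
  rw [← mk_mul_of f hf, ← mk_mul_of g hg]
  exact h x hx

theorem exists_mul_of_ne_zero {q : MartindaleQuotient A} (hq : q ≠ 0) :
    ∃ x a, a ≠ 0 ∧ q * of x = of a := by
  obtain ⟨J, hJ, h⟩ := exists_ideal_mul_of_eq q
  by_contra hcon
  push Not at hcon
  refine hq (ext_of_ideal hJ fun x hx => ?_)
  obtain ⟨a, ha⟩ := h x hx
  rw [zero_mul, ha]
  by_contra h0
  exact hcon x a (fun h => h0 (by rw [h, map_zero])) ha

/-- If `p A q = 0` in the Martindale quotient ring, then `p = 0` or `q = 0`. -/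
theorem eq_zero_or_eq_zero_of_forall_mul_of_mul {p q : MartindaleQuotient A}
    (h : ∀ a, p * of a * q = 0) : p = 0 ∨ q = 0 := by
  by_contra hcon
  push Not at hcon
  obtain ⟨x, a, ha, hxa⟩ := exists_mul_of_ne_zero hcon.1
  obtain ⟨y, b, hb, hyb⟩ := exists_mul_of_ne_zero hcon.2
  rcases IsPrimeRing.eq_zero_or_eq_zero a b (fun r => of_injective (by
    have h1 := h (x * r)
    have h2 : p * of (x * r) * q * of y = of a * of r * of b := by
      rw [map_mul, ← mul_assoc, hxa, mul_assoc _ q, hyb]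
    rw [map_mul, map_mul, ← h2, h1, zero_mul, map_zero])) with h | h
  · exact ha h
  · exact hb h

/-- Nonzero central elements of the Martindale quotient ring are invertible. -/
theorem exists_inv_of_central {z : MartindaleQuotient A} (hz : ∀ q, z * q = q * z) (hz0 : z ≠ 0) :
    ∃ w, (∀ q, w * q = q * w) ∧ z * w = 1 := by
  have hinj : ∀ {x y : A}, z * of x = z * of y → x = y := by
    intro x y h
    refine sub_eq_zero.1 (of_injective ?_)
    refine ((eq_zero_or_eq_zero_of_forall_mul_of_mul (p := z) (q := of (x - y))
      fun a => ?_).resolve_left hz0).trans (map_zero _).symm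
    rw [hz, mul_assoc, map_sub, mul_sub, h, sub_self, mul_zero]
  -- This is `zA ∩ A`, two-sided because `z` is central. The inverse of `z` is the class of `zx ↦
  -- x`, well defined because multiplication by `z` is injective on `A`.
  let I : TwoSidedIdeal A := TwoSidedIdeal.mk' {a | ∃ x, of a = z * of x}
    ⟨0, by simp⟩
    (by
      rintro a b ⟨x, hx⟩ ⟨y, hy⟩
      exact ⟨x + y, by rw [map_add, map_add, mul_add, hx, hy]⟩)
    (by
      rintro a ⟨x, hx⟩
      exact ⟨-x, by rw [map_neg, map_neg, mul_neg, hx]⟩)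
    (by
      rintro r a ⟨x, hx⟩
      exact ⟨r * x, by rw [map_mul, map_mul, hx, ← mul_assoc, ← hz, mul_assoc]⟩)
    (by
      rintro a r ⟨x, hx⟩
      exact ⟨x * r, by rw [map_mul, map_mul, hx, mul_assoc]⟩)
  have hI : ∀ {a}, a ∈ I ↔ ∃ x, of a = z * of x := by
    intro a
    rw [TwoSidedIdeal.mem_mk']
    rfl
  choose φ hφ using fun a : I => hI.1 a.2
  obtain ⟨x₀, a₀, ha₀, hxa⟩ := exists_mul_of_ne_zero hz0
  let g : IdealHom A :=
    { dom := I
      dom_ne_bot := ne_bot_iff.2 ⟨a₀, hI.2 ⟨x₀, hxa.symm⟩, ha₀⟩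
      hom := mkHom I φ
        (fun a b => hinj (by
          rw [← hφ, map_add, mul_add, ← hφ, ← hφ, ← map_add]
          rfl))
        (fun a ha r => hinj (by rw [← hφ, map_mul, map_mul, ← mul_assoc, ← hφ])) }
  have hg : ∀ {a x}, of a = z * of x → mk g * of a = of x := fun {a x} h => by
    rw [mk_mul_of g (hI.2 ⟨x, h⟩)]
    exact congrArg of (hinj ((hφ ⟨a, hI.2 ⟨x, h⟩⟩).symm.trans h))
  obtain ⟨J, hJ, hJz⟩ := exists_ideal_mul_of_eq z
  have h1 : mk g * z = 1 := by
    refine ext_of_ideal hJ fun x hx => ?_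
    obtain ⟨a, ha⟩ := hJz x hx
    rw [mul_assoc, ha, hg ha.symm, one_mul]
  have h2 : z * mk g = 1 := by rw [hz, h1]
  refine ⟨mk g, fun q => ?_, h2⟩
  calc mk g * q = mk g * (q * (z * mk g)) := by rw [h2, mul_one]
    _ = mk g * (q * z) * mk g := by simp only [mul_assoc]
    _ = mk g * (z * q) * mk g := by rw [hz q]
    _ = q * mk g := by rw [← mul_assoc (mk g) z q, h1, one_mul]

theorem exists_ideal_forall_mul_of_eq (F : Finset (MartindaleQuotient A)) :
    ∃ J : TwoSidedIdeal A, J ≠ ⊥ ∧ ∀ q ∈ F, ∀ x ∈ J, ∃ a, q * of x = of a := by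
  classical
  induction F using Finset.induction_on with
  | empty => exact ⟨⊤, top_ne_bot, by simp⟩
  | insert q F _ ih =>
    obtain ⟨J, hJ, h⟩ := ih
    obtain ⟨J', hJ', h'⟩ := exists_ideal_mul_of_eq q
    refine ⟨J ⊓ J', inf_ne_bot hJ hJ', fun p hp x hx => ?_⟩
    obtain ⟨hx, hx'⟩ := (TwoSidedIdeal.mem_inf A).1 hx
    rcases Finset.mem_insert.1 hp with rfl | hp
    · exact h' x hx'
    · exact h p hp x hx

end MartindaleQuotient

/-! ### The central closure and the main theorem -/

open MartindaleQuotient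

theorem isField_extendedCentre (K A : Type*) [Field K] [Ring A] [IsPrimeRing A] [Algebra K A] :
    IsField (extendedCentre K A) where
  exists_pair_ne := ⟨0, 1, fun h => by
    have := IsPrimeRing.nontrivial (A := A)
    have h1 : (of (0 : A)) = of 1 := by
      rw [map_zero, map_one]; exact congrArg Subtype.val h
    exact zero_ne_one (of_injective h1)⟩
  mul_comm := mul_comm
  mul_inv_cancel := by
    rintro ⟨z, hz⟩ h0
    rw [Subalgebra.mem_center_iff] at hz
    obtain ⟨w, hw, h⟩ := exists_inv_of_central (fun q => (hz q).symm) fun h => h0 (Subtype.ext h)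
    exact ⟨⟨w, Subalgebra.mem_center_iff.2 fun q => (hw q).symm⟩, Subtype.ext h⟩

theorem exists_isFrame {K A : Type*} [Field K] [Ring A] [Algebra K A]
    (hfg : Algebra.FiniteType K A) : ∃ V : Submodule K A, IsFrame V := by
  classical
  obtain ⟨s, hs⟩ := hfg.out
  refine ⟨Submodule.span K (insert 1 s : Finset A), Submodule.subset_span (by simp),
    inferInstance, ?_⟩
  rw [Algebra.adjoin_span, eq_top_iff, ← hs]
  exact Algebra.adjoin_mono (by simp)

/-- A prime affine algebra of quadratic growth is PI if a transcendental extension of the ground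
field acts centrally on its Martindale ring of quotients. -/
theorem isPIAlgebra_of_transcendental {K A L : Type*} [Field K] [Ring A] [Algebra K A]
    [IsPrimeRing A] [Field L] [Algebra K L] [Algebra L (MartindaleQuotient A)]
    [IsScalarTower K L (MartindaleQuotient A)] (hfg : Algebra.FiniteType K A)
    (hquad : HasQuadraticGrowth K A) {z : L} (hz : Transcendental K z) : IsPIAlgebra K A := by
  obtain ⟨V₀, hV₀⟩ := exists_isFrame hfg
  obtain ⟨C₁, C₂, -, hC₂, hgrow⟩ := hquad V₀ hV₀
  -- The central closure of `A` when `L` is the extended centre.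
  let B : Subalgebra L (MartindaleQuotient A) := Algebra.adjoin L (Set.range (of (A := A)))
  let ι : A →ₐ[K] B :=
    { (of (A := A)).codRestrict B (fun a => Algebra.subset_adjoin ⟨a, rfl⟩) with
      commutes' := fun k => Subtype.ext (by
        change of (algebraMap K A k) = ((algebraMap K B k : B) : MartindaleQuotient A)
        rfl) }
  have hι : ∀ a, (ι a : MartindaleQuotient A) = of a := fun a => rfl
  have hιinj : Function.Injective ι := fun a b h => of_injective (congrArg Subtype.val h)
  suffices h : ∃ N, SatisfiesStandard N B by
    obtain ⟨N, h⟩ := h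
    exact (h.of_injective ι.toRingHom hιinj).isPIAlgebra
  by_cases hB : FiniteDimensional L B
  · exact ⟨_, satisfiesStandard_of_finite L B⟩
  have hprime : IsPrimeRing B :=
    { nontrivial := by
        have := IsPrimeRing.nontrivial (A := A)
        exact hιinj.nontrivial
      eq_zero_or_eq_zero := fun p q h => by
        refine (eq_zero_or_eq_zero_of_forall_mul_of_mul (p := p.1) (q := q.1) fun a => ?_).imp
          Subtype.ext Subtype.ext
        exact congrArg Subtype.val (h (ι a)) }
  let V : Submodule K B := V₀.map ι.toLinearMap
  have hVpow : ∀ n, V ^ n = (V₀ ^ n).map ι.toLinearMap := fun n => (Submodule.map_pow _ _ _).symm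
  have hadj : ∀ a, ι a ∈ Algebra.adjoin K (V : Set B) := fun a => by
    have : Algebra.adjoin K (V : Set B) = (Algebra.adjoin K (V₀ : Set A)).map ι := by
      rw [AlgHom.map_adjoin]; rfl
    rw [this, hV₀.adjoin_eq_top]
    exact ⟨a, trivial, rfl⟩
  have hV1 : (1 : B) ∈ V := ⟨1, hV₀.one_mem, map_one ι⟩
  have hVf : ∀ n, FiniteDimensional K ↥(V ^ n) := fun n => by
    have := hV₀.finite_pow n
    rw [hVpow]
    infer_instance
  have hW : IsFrame (Submodule.span L (V : Set B)) := by
    refine ⟨Submodule.subset_span hV1, ?_, ?_⟩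
    · obtain ⟨s, hs⟩ : V.FG := (Module.Finite.iff_fg.1 hV₀.finite).map _
      rw [← hs, Submodule.span_span_of_tower]
      exact FiniteDimensional.span_of_finite _ s.finite_toSet
    · rw [Algebra.adjoin_span]
      have hle : B ≤ (Algebra.adjoin L (V : Set B)).map B.val := by
        refine Algebra.adjoin_le ?_
        rintro _ ⟨a, rfl⟩
        have h1 : Algebra.adjoin K (V : Set B) ≤
            (Algebra.adjoin L (V : Set B)).restrictScalars K :=
          Algebra.adjoin_le Algebra.subset_adjoin
        exact ⟨ι a, h1 (hadj a), rfl⟩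
      refine eq_top_iff.2 fun b _ => ?_
      obtain ⟨b', hb', h⟩ := hle b.2
      exact (Subtype.ext h : b' = b) ▸ hb'
  -- Finitely many elements of `L` carry a common nonzero ideal of `A` into `A`; any nonzero element
  -- of it is a common denominator.
  have H : ∀ F : Finset L, ∃ y : B, y ≠ 0 ∧ ∀ f ∈ F, f • y ∈ Algebra.adjoin K (V : Set B) := by
    classical
    intro F
    obtain ⟨J, hJ, h⟩ := exists_ideal_forall_mul_of_eq
      (F.image (algebraMap L (MartindaleQuotient A)))
    obtain ⟨x, hx, hx0⟩ := IdealHom.ne_bot_iff.1 hJ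
    refine ⟨ι x, fun h => hx0 (hιinj (h.trans (map_zero ι).symm)), fun f hf => ?_⟩
    obtain ⟨a, ha⟩ := h _ (Finset.mem_image_of_mem _ hf) x hx
    have : f • ι x = ι a := Subtype.ext ((Algebra.smul_def _ _).trans ha)
    rw [this]
    exact hadj a
  have hC : ∀ n, 1 ≤ n → finrank K ↥(V ^ n) ≤ ⌈C₂⌉₊ * n ^ 2 := by
    intro n hn
    have := hV₀.finite_pow n
    have h1 : finrank K ↥(V ^ n) ≤ finrank K ↥(V₀ ^ n) := by
      rw [hVpow]; exact Submodule.finrank_map_le _ _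
    refine h1.trans ?_
    have h2 := (hgrow n hn).2
    have h3 : (finrank K ↥(V₀ ^ n) : ℝ) ≤ (⌈C₂⌉₊ * n ^ 2 : ℕ) := by
      push_cast
      exact h2.le.trans (mul_le_mul_of_nonneg_right (Nat.le_ceil C₂) (by positivity))
    exact_mod_cast h3
  rcases exists_satisfiesStandard_or_sq_le_finrank hW hB with h | ⟨a, ha⟩
  · exact h
  · exact (false_of_transcendental hz hV1 hVf hW hB hC H ha).elim

/-- A prime affine algebra of quadratic growth is PI or has algebraic extended centre; over an
algebraically closed field the non-PI ones are centrally closed (the extended centre is `K`). -/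
theorem theorem1p3 {K A : Type*} [Field K] [Ring A] [Algebra K A] [IsPrimeRing A]
    (hfg : Algebra.FiniteType K A) (hquad : HasQuadraticGrowth K A) :
    (IsPIAlgebra K A ∨ Algebra.IsAlgebraic K (extendedCentre K A)) ∧
      (IsAlgClosed K → ¬ IsPIAlgebra K A → extendedCentre K A = ⊥) := by
  have hfield := isField_extendedCentre K A
  have hmain : IsPIAlgebra K A ∨ Algebra.IsAlgebraic K (extendedCentre K A) := by
    refine or_iff_not_imp_right.2 fun halg => ?_
    obtain ⟨z, hz⟩ := Algebra.transcendental_iff_not_isAlgebraic.2 halg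
    let : Field (extendedCentre K A) := hfield.toField
    let : Algebra (extendedCentre K A) (MartindaleQuotient A) :=
      (extendedCentre K A).val.toRingHom.toAlgebra'
        fun z q => (Subalgebra.mem_center_iff.1 z.2 q).symm
    exact @isPIAlgebra_of_transcendental K A (extendedCentre K A) _ _ _ _ _ _ _
      (.of_algebraMap_eq fun _ => rfl) hfg hquad z hz
  refine ⟨hmain, fun hK hPI => ?_⟩
  have halg := hmain.resolve_left hPI
  have := hfield.isDomain
  have hbij := IsAlgClosed.algebraMap_bijective_of_isIntegral (k := K) (K := extendedCentre K A)
  refine eq_bot_iff.2 fun z hz => ?_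
  obtain ⟨k, hk⟩ := hbij.2 ⟨z, hz⟩
  exact Algebra.mem_bot.2 ⟨k, congrArg Subtype.val hk⟩
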